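/- Let $\mathbb K$ be a field of characteristic $0$ and $\mathfrak g$ a finite-dimensional Lie algebra over $\mathbb K$ with radical $\mathfrak r$. A Lie subalgebra of $\mathfrak{gl}(\mathfrak g)$ is called completely reducible if every subspace of $\mathfrak g$ stable under it has a stable complement. Let $e(\mathrm{ad}\,\mathfrak g)$ be the smallest algebraic Lie subalgebra of $\mathfrak{gl}(\mathfrak g)$ (that is, Lie algebra of an algebraic subgroup of $GL(\mathfrak g)$) containing $\mathrm{ad}\,\mathfrak g$, and let $\Gamma$ be maximal among the completely reducible Lie subalgebras of $e(\mathrm{ad}\,\mathfrak g)$. Let $(\mathfrak s,\mathfrak k,\mathfrak m)$ be a $\Gamma$-triple of $\mathfrak g$: $\mathfrak s$ is a Levi subalgebra of $\mathfrak g$, $\mathfrak k$ is a nilpotent Lie subalgebra with $[\mathfrak s,\mathfrak k]=0$, and $\mathfrak m\subseteq\mathfrak r$ is a subspace with $\mathfrak r=\mathfrak m\oplus\mathfrak k$ and $[\mathfrak s\oplus\mathfrak k,\mathfrak m]=\mathfrak m$ (so $\mathfrak g=\mathfrak s\oplus\mathfrak k\oplus\mathfrak m$), attached to $\Gamma$ by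 $\mathrm{ad}\,\mathfrak s\subseteq\Gamma$, $\mathfrak k=\mathfrak g^{\Gamma}=\{x:\gamma x=0\ \forall\gamma\in\Gamma\}$ and $\mathfrak m=\Gamma\cdot\mathfrak r$ (the span of all $\gamma x$, $\gamma\in\Gamma$, $x\in\mathfrak r$). Let $\mu:\mathfrak k\to\mathfrak{gl}(\mathfrak m)$, $\mu(x)=\mathrm{ad}\,x|_{\mathfrak m}$, and assume that $\mu$ is injective. Let $\hat{\mathfrak n}$ be the Lie subalgebra of $\mathfrak g$ generated by $\mathfrak m$ (it is stable under $\Gamma$), and let $\mathfrak B\subseteq\mathfrak{gl}(\mathfrak m)$ be the Lie algebra of those endomorphisms of $\mathfrak m$ that are restrictions to $\mathfrak m$ of derivations of $\hat{\mathfrak n}$ commuting with $\Gamma|_{\hat{\mathfrak n}}$; it contains $\mu(\mathfrak k)$. Then $\mathfrak g'=\mathfrak s\oplus\mathfrak B\oplus\mathfrak m$ is a Lie algebra for the bilinear antisymmetric bracket $\Phi$ given, for $x,x'\in\mathfrak s$, $y,y'\in\mathfrak B$, $z,z'\in\mathfrak m$, by $$\Phi(x,x')=[x,x'],\quad \Phi(x,y)=0,\quad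 \Phi(x,z)=[x,z],\quad \Phi(y,y')=yy'-y'y,\quad \Phi(y,z)=y(z),\quad \Phi(z,z')=\mu(a)+c,$$ where $a\in\mathfrak k$ and $c\in\mathfrak m$ are the components of $[z,z']\in\mathfrak r=\mathfrak k\oplus\mathfrak m$; and $\mathfrak g'$ is complete: its center is trivial and all its derivations are inner. -/

import Mathlib

universe u v

attribute [local instance] LieRing.ofAssociativeRing

namespace GammaDecomp

section AlgebraicHull

variable {K : Type u} [Field K] {ι : Type} [Fintype ι] [DecidableEq ι]

/-- The matrix `A` over the commutative `K`-algebra `R` is a common zero of the polynomials `I`. -/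
def IsZeroOf (I : Set (MvPolynomial (ι × ι) K)) {R : Type u} [CommRing R] [Algebra K R]
    (A : Matrix ι ι R) : Prop :=
  ∀ P ∈ I, MvPolynomial.aeval (fun p : ι × ι => A p.1 p.2) P = 0

/-- The polynomials `I` define an algebraic subgroup of `GL_ι` over `K`: for every commutative
`K`-algebra `R`, the solutions of `I` in `GL_ι(R)` form a subgroup. -/
def IsAlgebraicGroup (I : Set (MvPolynomial (ι × ι) K)) : Prop :=
  ∀ (R : Type u) [CommRing R] [Algebra K R],
    ∃ H : Subgroup (Matrix.GeneralLinearGroup ι R),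
      ∀ A : Matrix.GeneralLinearGroup ι R, A ∈ H ↔ IsZeroOf I A.val

/-- `X` is tangent at the identity to the algebraic group defined by `I`: the matrix `1 + ε X`
over the dual numbers `K[ε]` is a zero of `I`. -/
def IsTangent (I : Set (MvPolynomial (ι × ι) K)) (X : Matrix ι ι K) : Prop :=
  IsZeroOf I (R := DualNumber K)
    ((1 : Matrix ι ι (DualNumber K)) + X.map (TrivSqZeroExt.inr : K → DualNumber K))

variable {V : Type v} [AddCommGroup V] [Module K V] [FiniteDimensional K V]

/-- A Lie subalgebra of `gl(V)` is algebraic if it is the Lie algebra of an algebraic subgroup of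
`GL(V)` (`GL(V)` being identified with a matrix group by means of a basis). -/
def IsAlgebraic (M : LieSubalgebra K (Module.End K V)) : Prop :=
  ∃ I : Set (MvPolynomial (Fin (Module.finrank K V) × Fin (Module.finrank K V)) K),
    IsAlgebraicGroup I ∧
      ∀ X : Module.End K V,
        X ∈ M ↔ IsTangent I
          (LinearMap.toMatrix (Module.finBasis K V) (Module.finBasis K V) X)

/-- `e(M)`: the smallest algebraic Lie subalgebra of `gl(V)` that contains `M`. -/
def algebraicHull (M : LieSubalgebra K (Module.End K V)) : LieSubalgebra K (Module.End K V) :=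
  sInf {N | IsAlgebraic N ∧ M ≤ N}

theorem algebraicHull_le {M N : LieSubalgebra K (Module.End K V)} (hN : IsAlgebraic N)
    (h : M ≤ N) : algebraicHull M ≤ N :=
  sInf_le ⟨hN, h⟩

end AlgebraicHull

section Der

variable (K : Type u) [Field K] (L : Type v) [LieRing L] [LieAlgebra K L]

/-- `Der L` as a Lie subalgebra of `gl(L)`. -/
def derSubalgebra : LieSubalgebra K (Module.End K L) where
  carrier := {D | ∀ x y : L, D ⁅x, y⁆ = ⁅D x, y⁆ + ⁅x, D y⁆}
  add_mem' := by
    intro a b ha hb x y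
    simp only [Set.mem_ofPred_eq] at ha hb
    simp only [LinearMap.add_apply, ha, hb, add_lie, lie_add]
    abel
  zero_mem' := by intro x y; simp
  smul_mem' := by
    intro c a ha x y
    simp only [Set.mem_ofPred_eq] at ha
    simp only [LinearMap.smul_apply, ha, smul_add, smul_lie, lie_smul]
  lie_mem' := by
    intro a b ha hb x y
    have ha' : ∀ x y : L, a ⁅x, y⁆ = ⁅a x, y⁆ + ⁅x, a y⁆ := ha
    have hb' : ∀ x y : L, b ⁅x, y⁆ = ⁅b x, y⁆ + ⁅x, b y⁆ := hb
    simp only [Ring.lie_def, LinearMap.sub_apply, Module.End.mul_apply, ha', hb', map_add,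
      sub_lie, lie_sub]
    abel

variable [FiniteDimensional K L]

/-- The structure constants. -/
noncomputable def structConst {ι : Type} (b : Module.Basis ι K L) (i j l : ι) : K := b.repr ⁅b i, b j⁆ l

variable {K L} in
/-- The equation `g [b i, b j] = [g (b i), g (b j)]`, `l`-th coordinate. -/
noncomputable def autPoly {ι : Type} [Fintype ι] (b : Module.Basis ι K L) (i j l : ι) :
    MvPolynomial (ι × ι) K :=
  ∑ p, MvPolynomial.C (structConst K L b i j p) * MvPolynomial.X (l, p)
    - ∑ p, ∑ q, MvPolynomial.C (structConst K L b p q l) *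
        (MvPolynomial.X (p, i) * MvPolynomial.X (q, j))

open TensorProduct in
theorem isAlgebraic_derSubalgebra : IsAlgebraic (derSubalgebra K L) := by
  classical
  set b := Module.finBasis K L with hb
  refine ⟨{P | ∃ i j l, P = autPoly b i j l}, ?_, ?_⟩
  · intro R _ _
    let bR := Algebra.TensorProduct.basis R b
    have key : ∀ A : Matrix.GeneralLinearGroup (Fin (Module.finrank K L)) R,
        IsZeroOf {P | ∃ i j l, P = autPoly b i j l} A.val ↔
          ∀ x y : R ⊗[K] L, Matrix.toLin bR bR A.val ⁅x, y⁆ =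
            ⁅Matrix.toLin bR bR A.val x, Matrix.toLin bR bR A.val y⁆ := by
      intro A
      have hbb : ∀ i j, ⁅bR i, bR j⁆ = ∑ p, structConst K L b i j p • bR p := by
        intro i j
        simp only [bR, Algebra.TensorProduct.basis_apply,
          LieAlgebra.ExtendScalars.bracket_tmul, mul_one]
        conv_lhs => rw [← b.sum_repr ⁅b i, b j⁆, TensorProduct.tmul_sum]
        simp only [TensorProduct.tmul_smul, structConst]
      have hb1 : ∀ i j l, bR.repr (Matrix.toLin bR bR A.val ⁅bR i, bR j⁆) l =
          ∑ p, algebraMap K R (structConst K L b i j p) * A.val l p := by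
        intro i j l
        rw [hbb]
        simp only [map_sum, LinearMap.map_smul_of_tower]
        simp [Matrix.toLin_self, Finsupp.single_apply, algebra_compatible_smul R]
      have hb2 : ∀ i j l, bR.repr ⁅Matrix.toLin bR bR A.val (bR i),
          Matrix.toLin bR bR A.val (bR j)⁆ l =
          ∑ p, ∑ q, algebraMap K R (structConst K L b p q l) * (A.val p i * A.val q j) := by
        intro i j l
        simp only [Matrix.toLin_self, sum_lie, lie_sum, smul_lie, lie_smul, hbb]
        simp [Finsupp.single_apply, algebra_compatible_smul R]
        rw [Finset.sum_comm]
        refine Finset.sum_congr rfl fun p _ => ?_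
        rw [Finset.mul_sum]
        refine Finset.sum_congr rfl fun q _ => ?_
        ring
      constructor
      · intro h
        have h0 : ∀ i j, Matrix.toLin bR bR A.val ⁅bR i, bR j⁆ =
            ⁅Matrix.toLin bR bR A.val (bR i), Matrix.toLin bR bR A.val (bR j)⁆ := by
          intro i j
          apply bR.repr.injective
          ext l
          rw [hb1, hb2]
          have := h _ ⟨i, j, l, rfl⟩
          simpa [autPoly, sub_eq_zero] using this
        let f := Matrix.toLin bR bR A.val
        let B : (R ⊗[K] L) →ₗ[R] (R ⊗[K] L) →ₗ[R] (R ⊗[K] L) :=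
          (LieModule.toEnd R (R ⊗[K] L) (R ⊗[K] L)).toLinearMap
        have hB : B.compr₂ f = B.compl₁₂ f f := LinearMap.ext_basis bR bR h0
        intro x y
        exact LinearMap.congr_fun₂ hB x y
      · rintro h _ ⟨i, j, l, rfl⟩
        have := congrArg (fun z => bR.repr z l) (h (bR i) (bR j))
        simp only [hb1, hb2] at this
        simpa [autPoly, sub_eq_zero] using this
    refine ⟨{ carrier := {A | ∀ x y : R ⊗[K] L, Matrix.toLin bR bR A.val ⁅x, y⁆ =
                ⁅Matrix.toLin bR bR A.val x, Matrix.toLin bR bR A.val y⁆}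
              mul_mem' := ?_
              one_mem' := ?_
              inv_mem' := ?_ }, fun A => (key A).symm⟩
    · intro A A' h h' x y
      have h1 : ∀ x y : R ⊗[K] L, Matrix.toLin bR bR A.val ⁅x, y⁆ =
                ⁅Matrix.toLin bR bR A.val x, Matrix.toLin bR bR A.val y⁆ := h
      have h2 : ∀ x y : R ⊗[K] L, Matrix.toLin bR bR A'.val ⁅x, y⁆ =
                ⁅Matrix.toLin bR bR A'.val x, Matrix.toLin bR bR A'.val y⁆ := h'
      simp only [Units.val_mul, Matrix.toLin_mul_apply bR bR bR, h1, h2]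
    · intro x y
      simp
    · intro A h x y
      have h1 : ∀ x y : R ⊗[K] L, Matrix.toLin bR bR A.val ⁅x, y⁆ =
                ⁅Matrix.toLin bR bR A.val x, Matrix.toLin bR bR A.val y⁆ := h
      have e1 : ∀ z, Matrix.toLin bR bR A.val (Matrix.toLin bR bR (A⁻¹).val z) = z := by
        intro z
        rw [← Matrix.toLin_mul_apply bR bR bR, ← Units.val_mul, mul_inv_cancel]
        simp
      have e2 : ∀ z, Matrix.toLin bR bR (A⁻¹).val (Matrix.toLin bR bR A.val z) = z := by
        intro z
        rw [← Matrix.toLin_mul_apply bR bR bR, ← Units.val_mul, inv_mul_cancel]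
        simp
      conv_lhs => rw [← e1 x, ← e1 y, ← h1, e2]
  · intro X
    set M := LinearMap.toMatrix b b X with hM
    have hX : ∀ i, X (b i) = ∑ p, M p i • b p := by
      intro i
      rw [hM]
      simp only [LinearMap.toMatrix_apply]
      exact (b.sum_repr (X (b i))).symm
    have h1 : ∀ i j l, b.repr (X ⁅b i, b j⁆) l = ∑ p, structConst K L b i j p * M l p := by
      intro i j l
      conv_lhs => rw [← b.sum_repr ⁅b i, b j⁆]
      simp only [map_sum, map_smul, hX, structConst]
      simp [Finsupp.single_apply]
    have h2 : ∀ i j l, b.repr ⁅X (b i), b j⁆ l = ∑ p, structConst K L b p j l * M p i := by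
      intro i j l
      simp only [hX, sum_lie, smul_lie, map_sum, map_smul, structConst]
      simp [mul_comm]
    have h3 : ∀ i j l, b.repr ⁅b i, X (b j)⁆ l = ∑ p, structConst K L b i p l * M p j := by
      intro i j l
      simp only [hX, lie_sum, lie_smul, map_sum, map_smul, structConst]
      simp [mul_comm]
    have key : IsTangent {P | ∃ i j l, P = autPoly b i j l} M ↔
        ∀ i j l, b.repr (X ⁅b i, b j⁆) l =
          b.repr ⁅X (b i), b j⁆ l + b.repr ⁅b i, X (b j)⁆ l := by
      have hval : ∀ i j l, MvPolynomial.aeval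
          (fun p : Fin (Module.finrank K L) × Fin (Module.finrank K L) =>
            ((1 : Matrix (Fin (Module.finrank K L)) (Fin (Module.finrank K L)) (DualNumber K)) +
              M.map (TrivSqZeroExt.inr : K → DualNumber K)) p.1 p.2) (autPoly b i j l) =
          TrivSqZeroExt.inr (b.repr (X ⁅b i, b j⁆) l -
            (b.repr ⁅X (b i), b j⁆ l + b.repr ⁅b i, X (b j)⁆ l)) := by
        intro i j l
        have hf : ∀ r s : Fin (Module.finrank K L),
            TrivSqZeroExt.fst ((1 : Matrix (Fin (Module.finrank K L)) (Fin (Module.finrank K L))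
                (DualNumber K)) r s) =
              if r = s then (1 : K) else 0 := by
          intro r s
          rw [Matrix.one_apply]; split_ifs <;> simp
        have hs : ∀ r s : Fin (Module.finrank K L),
            TrivSqZeroExt.snd ((1 : Matrix (Fin (Module.finrank K L)) (Fin (Module.finrank K L))
                (DualNumber K)) r s) = (0 : K) := by
          intro r s
          rw [Matrix.one_apply]; split_ifs <;> simp
        simp only [h1, h2, h3]
        ext
        · simp [autPoly, hf, TrivSqZeroExt.fst_sum, TrivSqZeroExt.algebraMap_eq_inl]
        · simp [autPoly, hf, hs, TrivSqZeroExt.snd_sum, TrivSqZeroExt.algebraMap_eq_inl, mul_add,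
            Finset.sum_add_distrib]
          simp only [mul_comm]
      constructor
      · intro h i j l
        have := (hval i j l).symm.trans (h _ ⟨i, j, l, rfl⟩)
        have := congrArg TrivSqZeroExt.snd this
        simpa [sub_eq_zero] using this
      · rintro h _ ⟨i, j, l, rfl⟩
        rw [hval, h, sub_self, TrivSqZeroExt.inr_zero]
    rw [key]
    constructor
    · intro h i j l
      have h' : ∀ x y : L, X ⁅x, y⁆ = ⁅X x, y⁆ + ⁅x, X y⁆ := h
      rw [h']
      simp
    · intro h
      let B : L →ₗ[K] L →ₗ[K] L := (LieModule.toEnd K L L).toLinearMap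
      have hB : B.compr₂ X = B.compl₁₂ X LinearMap.id + B.compl₁₂ LinearMap.id X := by
        refine LinearMap.ext_basis b b fun i j => b.repr.injective ?_
        ext l
        have := h i j l
        simpa [B] using this
      intro x y
      exact LinearMap.congr_fun₂ hB x y
end Der

section Triple

variable {K : Type u} [Field K]

/-- A Lie subalgebra `Γ` of `gl(V)` is completely reducible (c.r.) if its natural action on `V` is
semisimple: every `Γ`-stable subspace has a `Γ`-stable complement. -/
def IsCompletelyReducible {V : Type v} [AddCommGroup V] [Module K V]
    (Γ : LieSubalgebra K (Module.End K V)) : Prop :=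
  ∀ W : Submodule K V, (∀ γ ∈ Γ, ∀ w ∈ W, γ w ∈ W) →
    ∃ W' : Submodule K V, (∀ γ ∈ Γ, ∀ w ∈ W', γ w ∈ W') ∧ IsCompl W W'

/-- `Γ` is maximal among the completely reducible Lie subalgebras of `E`. -/
def IsMaximalCompletelyReducible {V : Type v} [AddCommGroup V] [Module K V]
    (E Γ : LieSubalgebra K (Module.End K V)) : Prop :=
  Maximal (fun Γ' : LieSubalgebra K (Module.End K V) => Γ' ≤ E ∧ IsCompletelyReducible Γ') Γ

variable {L : Type v} [LieRing L] [LieAlgebra K L]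

/-- A Levi subalgebra: a Lie subalgebra that is a vector space complement of the radical. -/
def IsLevi (s : LieSubalgebra K L) : Prop :=
  IsCompl s.toSubmodule (LieAlgebra.radical K L).toSubmodule

variable [FiniteDimensional K L]

/-- A `Γ`-triple `(s, k, m)` of the Lie algebra `L`, where `Γ` is a maximal completely reducible
subalgebra of `e(ad L)`.  The fields `levi`, ..., `lie_m` say that `s` is a Levi subalgebra, `k` is
a nilpotent subalgebra commuting with `s`, and `m` is a subspace with `rad L = m ⊕ k` and
`[s ⊕ k, m] = m`; hence `L = s ⊕ k ⊕ m`.  The last three fields express that the triple is the one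
attached to `Γ`: `ad s ⊆ Γ`, `k = L^Γ` and `m = Γ · rad L`. -/
structure GammaTriple (Γ : LieSubalgebra K (Module.End K L)) where
  s : LieSubalgebra K L
  k : LieSubalgebra K L
  m : Submodule K L
  mcr : IsMaximalCompletelyReducible (algebraicHull (LieAlgebra.ad K L).range) Γ
  levi : IsLevi s
  nilpotent_k : LieRing.IsNilpotent k
  lie_s_k : ∀ x ∈ s, ∀ y ∈ k, ⁅x, y⁆ = 0
  radical_eq : m ⊔ k.toSubmodule = (LieAlgebra.radical K L).toSubmodule
  disjoint_m_k : Disjoint m k.toSubmodule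
  lie_m : Submodule.span K {w : L | ∃ x ∈ s.toSubmodule ⊔ k.toSubmodule, ∃ z ∈ m, ⁅x, z⁆ = w} = m
  ad_s_mem : ∀ x ∈ s, LieAlgebra.ad K L x ∈ Γ
  mem_k_iff : ∀ x : L, x ∈ k ↔ ∀ γ ∈ Γ, γ x = 0
  m_eq : m = Submodule.span K {w : L | ∃ γ ∈ Γ, ∃ x ∈ LieAlgebra.radical K L, γ x = w}

namespace GammaTriple

variable {Γ : LieSubalgebra K (Module.End K L)}

theorem map_lie (T : GammaTriple Γ) {γ : Module.End K L} (hγ : γ ∈ Γ) (x y : L) :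
    γ ⁅x, y⁆ = ⁅γ x, y⁆ + ⁅x, γ y⁆ := by
  have h1 : (LieAlgebra.ad K L).range ≤ derSubalgebra K L := by
    rintro _ ⟨a, rfl⟩ x y
    simp
  exact algebraicHull_le (isAlgebraic_derSubalgebra K L) h1 (T.mcr.prop.1 hγ) x y

variable (T : GammaTriple Γ)

theorem m_le_radical {z : L} (hz : z ∈ T.m) : z ∈ LieAlgebra.radical K L := by
  have : T.m ≤ (LieAlgebra.radical K L).toSubmodule := T.radical_eq ▸ le_sup_left
  exact this hz

theorem map_m {γ : Module.End K L} (hγ : γ ∈ Γ) {z : L} (hz : z ∈ T.m) : γ z ∈ T.m := by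
  rw [T.m_eq]
  exact Submodule.subset_span ⟨γ, hγ, z, T.m_le_radical hz, rfl⟩

theorem lie_mem_m {x z : L} (hx : x ∈ T.s.toSubmodule ⊔ T.k.toSubmodule) (hz : z ∈ T.m) :
    ⁅x, z⁆ ∈ T.m := by
  rw [← T.lie_m]
  exact Submodule.subset_span ⟨x, hx, z, hz, rfl⟩

theorem s_lie_mem_m {x z : L} (hx : x ∈ T.s) (hz : z ∈ T.m) : ⁅x, z⁆ ∈ T.m :=
  T.lie_mem_m (Submodule.mem_sup_left hx) hz

theorem k_lie_mem_m {x z : L} (hx : x ∈ T.k) (hz : z ∈ T.m) : ⁅x, z⁆ ∈ T.m :=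
  T.lie_mem_m (Submodule.mem_sup_right hx) hz

theorem eq_zero_of_add {a b c : L} (ha : a ∈ T.s) (hb : b ∈ T.k) (hc : c ∈ T.m)
    (h : a + b + c = 0) : a = 0 ∧ b = 0 ∧ c = 0 := by
  have hbc : c + b ∈ (LieAlgebra.radical K L).toSubmodule := by
    rw [← T.radical_eq]
    exact Submodule.add_mem_sup hc hb
  have ha' : a ∈ (LieAlgebra.radical K L).toSubmodule := by
    have : a = -(c + b) := by rw [eq_neg_iff_add_eq_zero, ← h]; abel
    rw [this]; exact neg_mem hbc
  have ha0 : a = 0 := Submodule.disjoint_def.1 T.levi.disjoint a ha ha'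
  have hb' : b ∈ T.m := by
    have : b = -c := by rw [eq_neg_iff_add_eq_zero, ← h, ha0]; abel
    rw [this]; exact neg_mem hc
  have hb0 : b = 0 := Submodule.disjoint_def.1 T.disjoint_m_k b hb' hb
  refine ⟨ha0, hb0, ?_⟩
  simpa [ha0, hb0] using h

theorem sup_eq_top : T.s.toSubmodule ⊔ (T.m ⊔ T.k.toSubmodule) = ⊤ := by
  rw [T.radical_eq]; exact T.levi.sup_eq_top

theorem isCompl_k : IsCompl T.k.toSubmodule (T.s.toSubmodule ⊔ T.m) := by
  constructor
  · rw [Submodule.disjoint_def]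
    intro x hx hx'
    obtain ⟨a, ha, c, hc, rfl⟩ := Submodule.mem_sup.1 hx'
    exact neg_eq_zero.1 (T.eq_zero_of_add ha (neg_mem hx) hc (by abel)).2.1
  · rw [codisjoint_iff, ← T.sup_eq_top]
    ac_rfl

theorem isCompl_m : IsCompl T.m (T.s.toSubmodule ⊔ T.k.toSubmodule) := by
  constructor
  · rw [Submodule.disjoint_def]
    intro x hx hx'
    obtain ⟨a, ha, b, hb, rfl⟩ := Submodule.mem_sup.1 hx'
    exact neg_eq_zero.1 (T.eq_zero_of_add ha hb (neg_mem hx) (by abel)).2.2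
  · rw [codisjoint_iff, ← T.sup_eq_top]
    ac_rfl

/-- The projection of `L = s ⊕ k ⊕ m` onto `k`. -/
noncomputable def kProj : L →ₗ[K] T.k :=
  T.k.toSubmodule.projectionOnto (T.s.toSubmodule ⊔ T.m) T.isCompl_k

/-- The projection of `L = s ⊕ k ⊕ m` onto `m`. -/
noncomputable def mProj : L →ₗ[K] T.m :=
  T.m.projectionOnto (T.s.toSubmodule ⊔ T.k.toSubmodule) T.isCompl_m

theorem kProj_of_mem_m {z : L} (hz : z ∈ T.m) : T.kProj z = 0 :=
  (Submodule.projectionOnto_apply_eq_zero_iff T.isCompl_k).2 (Submodule.mem_sup_right hz)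

theorem mProj_of_mem_k {x : L} (hx : x ∈ T.k) : T.mProj x = 0 :=
  (Submodule.projectionOnto_apply_eq_zero_iff T.isCompl_m).2 (Submodule.mem_sup_right hx)

theorem kProj_of_mem_k {x : L} (hx : x ∈ T.k) : T.kProj x = ⟨x, hx⟩ :=
  Submodule.projectionOnto_apply_of_mem_left T.isCompl_k hx

theorem mProj_of_mem_m {z : L} (hz : z ∈ T.m) : T.mProj z = ⟨z, hz⟩ :=
  Submodule.projectionOnto_apply_of_mem_left T.isCompl_m hz

theorem decomp {x : L} (hx : x ∈ LieAlgebra.radical K L) :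
    x = (T.kProj x : L) + (T.mProj x : L) := by
  have hx' : x ∈ T.m ⊔ T.k.toSubmodule := by rw [T.radical_eq]; exact hx
  obtain ⟨z, hz, y, hy, rfl⟩ := Submodule.mem_sup.1 hx'
  rw [map_add, map_add, T.kProj_of_mem_m hz, T.kProj_of_mem_k hy, T.mProj_of_mem_m hz,
    T.mProj_of_mem_k hy, zero_add, add_zero, add_comm]

theorem decomp_lie (z w : T.m) :
    ⁅(z : L), (w : L)⁆ = (T.kProj ⁅(z : L), (w : L)⁆ : L) + (T.mProj ⁅(z : L), (w : L)⁆ : L) :=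
  T.decomp (lie_mem_right K L (LieAlgebra.radical K L) _ _ (T.m_le_radical w.2))

/-- `n̂`, the Lie subalgebra of `L` generated by `m`. -/
def nHat : LieSubalgebra K L := LieSubalgebra.lieSpan K L T.m

theorem m_le_nHat {z : L} (hz : z ∈ T.m) : z ∈ T.nHat := LieSubalgebra.subset_lieSpan hz

/-- A derivation of `L` that stabilizes `m` stabilizes `n̂`. -/
theorem der_mem_nHat {D : Module.End K L} (hD : ∀ x y : L, D ⁅x, y⁆ = ⁅D x, y⁆ + ⁅x, D y⁆)
    (hm : ∀ z ∈ T.m, D z ∈ T.m) {x : L} (hx : x ∈ T.nHat) : D x ∈ T.nHat := by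
  unfold nHat at hx
  induction hx using LieSubalgebra.lieSpan_induction with
  | mem x hx => exact T.m_le_nHat (hm x hx)
  | zero => rw [map_zero]; exact zero_mem _
  | add x y _ _ hx hy => rw [map_add]; exact add_mem hx hy
  | smul t x _ hx => rw [map_smul]; exact SMulMemClass.smul_mem t hx
  | lie x y hx' hy' hx hy =>
    rw [hD]
    exact add_mem (LieSubalgebra.lie_mem _ hx hy') (LieSubalgebra.lie_mem _ hx' hy)

theorem map_nHat {γ : Module.End K L} (hγ : γ ∈ Γ) {x : L} (hx : x ∈ T.nHat) : γ x ∈ T.nHat :=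
  T.der_mem_nHat (T.map_lie hγ) (fun _ hz => T.map_m hγ hz) hx

/-- The derivation `D` of `n̂` commutes with the restriction of `Γ` to `n̂`. -/
def CommutesWithGamma (D : LieDerivation K T.nHat T.nHat) : Prop :=
  ∀ (γ : Module.End K L) (hγ : γ ∈ Γ) (x : T.nHat),
    D ⟨γ x, T.map_nHat hγ x.2⟩ = ⟨γ (D x), T.map_nHat hγ (D x).2⟩

/-- `𝔅 = (Der n̂)^Γ|_m`: the endomorphisms of `m` that are restrictions of derivations of `n̂`
commuting with `Γ|_n̂`. -/
def frakB : LieSubalgebra K (Module.End K T.m) where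
  carrier := {y | ∃ D : LieDerivation K T.nHat T.nHat, T.CommutesWithGamma D ∧
    ∀ z : T.m, (D ⟨z, T.m_le_nHat z.2⟩ : L) = y z}
  zero_mem' := ⟨0, fun γ hγ x => by ext; simp, fun z => by simp⟩
  add_mem' := by
    rintro a b ⟨D, hD, hD'⟩ ⟨E, hE, hE'⟩
    refine ⟨D + E, fun γ hγ x => ?_, fun z => ?_⟩
    · ext
      simp [hD γ hγ x, hE γ hγ x]
    · simp [hD', hE']
  smul_mem' := by
    rintro c a ⟨D, hD, hD'⟩
    refine ⟨c • D, fun γ hγ x => ?_, fun z => ?_⟩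
    · ext
      simp [hD γ hγ x]
    · simp [hD']
  lie_mem' := by
    rintro a b ⟨D, hD, hD'⟩ ⟨E, hE, hE'⟩
    refine ⟨⁅D, E⁆, fun γ hγ x => ?_, fun z => ?_⟩
    · ext
      simp [hD γ hγ, hE γ hγ]
    · have e1 : E ⟨z, T.m_le_nHat z.2⟩ = ⟨b z, T.m_le_nHat (b z).2⟩ := Subtype.ext (hE' z)
      have e2 : D ⟨z, T.m_le_nHat z.2⟩ = ⟨a z, T.m_le_nHat (a z).2⟩ := Subtype.ext (hD' z)
      simp [e1, e2, hD', hE', Ring.lie_def]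

/-- `ad x` restricted to `m`, for `x ∈ s ⊕ k`. -/
def adM (x : L) (hx : x ∈ T.s.toSubmodule ⊔ T.k.toSubmodule) : Module.End K T.m :=
  (LieAlgebra.ad K L x).restrict fun _ hz => T.lie_mem_m hx hz

/-- The action of `s` on `m`. -/
def sAct : T.s →ₗ[K] Module.End K T.m where
  toFun x := T.adM x (Submodule.mem_sup_left x.2)
  map_add' x y := by ext z; exact add_lie (x : L) (y : L) (z : L)
  map_smul' c x := by ext z; exact smul_lie c (x : L) (z : L)

/-- The representation `μ : k → gl(m)`, `μ(x) = ad x|_m`. -/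
def mu : T.k →ₗ[K] Module.End K T.m where
  toFun x := T.adM x (Submodule.mem_sup_right x.2)
  map_add' x y := by ext z; exact add_lie (x : L) (y : L) (z : L)
  map_smul' c x := by ext z; exact smul_lie c (x : L) (z : L)

@[simp] theorem coe_sAct (x : T.s) (z : T.m) : (T.sAct x z : L) = ⁅(x : L), (z : L)⁆ := rfl

@[simp] theorem coe_mu (x : T.k) (z : T.m) : (T.mu x z : L) = ⁅(x : L), (z : L)⁆ := rfl

theorem lie_mem_nHat (x : T.k) {n : L} (hn : n ∈ T.nHat) : ⁅(x : L), n⁆ ∈ T.nHat :=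
  T.der_mem_nHat (D := LieAlgebra.ad K L (x : L)) (fun a b => by simp)
    (fun _ hz => T.k_lie_mem_m x.2 hz) hn

theorem mu_mem_frakB (x : T.k) : T.mu x ∈ T.frakB := by
  refine ⟨{ toLinearMap := (LieAlgebra.ad K L (x : L)).restrict fun n hn => T.lie_mem_nHat x hn
            leibniz' := ?_ }, ?_, ?_⟩
  · intro a b
    apply Subtype.ext
    change ⁅(x : L), ⁅(a : L), (b : L)⁆⁆ =
      ⁅(a : L), ⁅(x : L), (b : L)⁆⁆ - ⁅(b : L), ⁅(x : L), (a : L)⁆⁆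
    rw [leibniz_lie, ← lie_skew (b : L)]
    abel
  · intro γ hγ n
    apply Subtype.ext
    change ⁅(x : L), γ n⁆ = γ ⁅(x : L), (n : L)⁆
    rw [T.map_lie hγ, (T.mem_k_iff x).1 x.2 γ hγ, zero_lie, zero_add]
  · intro z
    rfl

/-- `μ` as a map from `k` to `𝔅`. -/
def muB : T.k →ₗ[K] T.frakB := T.mu.codRestrict T.frakB.toSubmodule T.mu_mem_frakB

/-- The vector space `s ⊕ 𝔅 ⊕ m`. -/
def Ext : Type v := T.s × T.frakB × T.m

instance : AddCommGroup T.Ext := inferInstanceAs (AddCommGroup (T.s × T.frakB × T.m))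

instance : Module K T.Ext := inferInstanceAs (Module K (T.s × T.frakB × T.m))

/-- The bracket of `s ⊕ 𝔅 ⊕ m`: for `x, x' ∈ s`, `y, y' ∈ 𝔅`, `z, z' ∈ m`,
`[x, x'] = [x, x']_L`, `[x, y] = 0`, `[x, z] = [x, z]_L`, `[y, y'] = y y' - y' y`, `[y, z] = y z`
and `[z, z'] = μ(a) + c` where `a` and `c` are the projections of `[z, z']_L` into `k` and `m`. -/
noncomputable instance : Bracket T.Ext T.Ext where
  bracket u v :=
    (⁅u.1, v.1⁆,
     ⁅u.2.1, v.2.1⁆ + T.muB (T.kProj ⁅(u.2.2 : L), (v.2.2 : L)⁆),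
     T.sAct u.1 v.2.2 - T.sAct v.1 u.2.2 + (u.2.1 : Module.End K T.m) v.2.2
       - (v.2.1 : Module.End K T.m) u.2.2 + T.mProj ⁅(u.2.2 : L), (v.2.2 : L)⁆)

theorem s_kProj (x : T.s) (z w : T.m) :
    T.kProj ⁅((T.sAct x z : T.m) : L), (w : L)⁆ + T.kProj ⁅(z : L), ((T.sAct x w : T.m) : L)⁆ = 0 := by
  rw [← map_add, coe_sAct, coe_sAct, ← leibniz_lie, T.decomp_lie z w, lie_add,
    T.lie_s_k _ x.2 _ (Subtype.prop _), zero_add]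
  exact T.kProj_of_mem_m (T.s_lie_mem_m x.2 (Subtype.prop _))

theorem s_mProj (x : T.s) (z w : T.m) :
    T.mProj ⁅((T.sAct x z : T.m) : L), (w : L)⁆ + T.mProj ⁅(z : L), ((T.sAct x w : T.m) : L)⁆ =
      T.sAct x (T.mProj ⁅(z : L), (w : L)⁆) := by
  rw [← map_add, coe_sAct, coe_sAct, ← leibniz_lie]
  conv_lhs => rw [T.decomp_lie z w]
  rw [lie_add, T.lie_s_k _ x.2 _ (Subtype.prop _), zero_add,
    T.mProj_of_mem_m (T.s_lie_mem_m x.2 (Subtype.prop _))]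
  rfl

theorem kProj_mem_nHat (z w : T.m) : (T.kProj ⁅(z : L), (w : L)⁆ : L) ∈ T.nHat := by
  have h : (T.kProj ⁅(z : L), (w : L)⁆ : L) =
      ⁅(z : L), (w : L)⁆ - (T.mProj ⁅(z : L), (w : L)⁆ : L) :=
    eq_sub_of_add_eq (T.decomp_lie z w).symm
  rw [h]
  exact sub_mem (LieSubalgebra.lie_mem _ (T.m_le_nHat z.2) (T.m_le_nHat w.2))
    (T.m_le_nHat (Subtype.prop _))

theorem B_brackets (y : T.frakB) (z w : T.m) :
    T.mProj ⁅(((y : Module.End K T.m) z : T.m) : L), (w : L)⁆ +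
        T.mProj ⁅(z : L), (((y : Module.End K T.m) w : T.m) : L)⁆ =
      (y : Module.End K T.m) (T.mProj ⁅(z : L), (w : L)⁆) ∧
    ⁅(y : Module.End K T.m), T.mu (T.kProj ⁅(z : L), (w : L)⁆)⁆ =
      T.mu (T.kProj ⁅(((y : Module.End K T.m) z : T.m) : L), (w : L)⁆) +
        T.mu (T.kProj ⁅(z : L), (((y : Module.End K T.m) w : T.m) : L)⁆) := by
  obtain ⟨y, D, hD, hy⟩ := y
  have ey : ∀ z : T.m, D ⟨z, T.m_le_nHat z.2⟩ = ⟨y z, T.m_le_nHat (y z).2⟩ :=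
    fun z => Subtype.ext (hy z)
  set a : T.nHat := ⟨T.kProj ⁅(z : L), (w : L)⁆, T.kProj_mem_nHat z w⟩ with ha
  set c : T.m := T.mProj ⁅(z : L), (w : L)⁆ with hc
  have hDa : (D a : L) ∈ T.k := by
    rw [T.mem_k_iff]
    intro γ hγ
    have h1 := congrArg Subtype.val (hD γ hγ a)
    have h2 : (⟨γ a, T.map_nHat hγ a.2⟩ : T.nHat) = 0 :=
      Subtype.ext ((T.mem_k_iff _).1 (Subtype.prop (T.kProj ⁅(z : L), (w : L)⁆)) γ hγ)
    rw [h2, map_zero] at h1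
    exact h1.symm
  have hzw : (⁅(⟨z, T.m_le_nHat z.2⟩ : T.nHat), (⟨w, T.m_le_nHat w.2⟩ : T.nHat)⁆ : T.nHat) =
      a + ⟨c, T.m_le_nHat c.2⟩ := Subtype.ext (T.decomp_lie z w)
  have hmain : ⁅((y z : T.m) : L), (w : L)⁆ + ⁅(z : L), ((y w : T.m) : L)⁆ =
      (D a : L) + (y c : T.m) := by
    have h := congrArg (fun n => ((D n : T.nHat) : L)) hzw
    simp only [LieDerivation.apply_lie_eq_add, map_add, ey] at h
    rw [add_comm]
    exact h
  constructor
  · change T.mProj ⁅((y z : T.m) : L), (w : L)⁆ + T.mProj ⁅(z : L), ((y w : T.m) : L)⁆ = y c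
    rw [← map_add, hmain, map_add, T.mProj_of_mem_k hDa, zero_add]
    exact T.mProj_of_mem_m (y c).2
  · change ⁅y, T.mu (T.kProj ⁅(z : L), (w : L)⁆)⁆ =
      T.mu (T.kProj ⁅((y z : T.m) : L), (w : L)⁆) + T.mu (T.kProj ⁅(z : L), ((y w : T.m) : L)⁆)
    rw [← map_add, ← map_add, hmain, map_add, T.kProj_of_mem_k hDa,
      T.kProj_of_mem_m (y c).2, add_zero]
    ext t
    have hat : (⁅a, (⟨t, T.m_le_nHat t.2⟩ : T.nHat)⁆ : T.nHat) =
      ⟨T.mu (T.kProj ⁅(z : L), (w : L)⁆) t, T.m_le_nHat (Subtype.prop _)⟩ := rfl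
    have h := congrArg (fun n => ((D n : T.nHat) : L)) hat
    simp only [LieDerivation.apply_lie_eq_add, ey] at h
    have h' : ⁅(a : L), ((y t : T.m) : L)⁆ + ⁅(D a : L), (t : L)⁆ =
      (y (T.mu (T.kProj ⁅(z : L), (w : L)⁆) t) : L) := h
    change ((y (T.mu (T.kProj ⁅(z : L), (w : L)⁆) t) : T.m) : L) -
      ⁅(a : L), ((y t : T.m) : L)⁆ = ⁅(D a : L), (t : L)⁆
    rw [← h']
    abel

/-- The elements of `𝔅` commute with the action of `s` on `m`. -/
theorem B_sAct (y : T.frakB) (x : T.s) (z : T.m) :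
    (y : Module.End K T.m) (T.sAct x z) = T.sAct x ((y : Module.End K T.m) z) := by
  obtain ⟨y, D, hD, hy⟩ := y
  have h := congrArg Subtype.val (hD _ (T.ad_s_mem x x.2) ⟨z, T.m_le_nHat z.2⟩)
  apply Subtype.ext
  change (y (T.sAct x z) : L) = ⁅(x : L), (y z : L)⁆
  rw [← hy, ← hy]
  exact h

theorem jacobi_parts (z1 z2 z3 : T.m) :
    T.kProj ⁅(z1 : L), (T.mProj ⁅(z2 : L), (z3 : L)⁆ : L)⁆ =
      T.kProj ⁅(T.mProj ⁅(z1 : L), (z2 : L)⁆ : L), (z3 : L)⁆ +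
      T.kProj ⁅(z2 : L), (T.mProj ⁅(z1 : L), (z3 : L)⁆ : L)⁆ ∧
    T.mProj ⁅(z1 : L), (T.mProj ⁅(z2 : L), (z3 : L)⁆ : L)⁆ -
        T.mu (T.kProj ⁅(z2 : L), (z3 : L)⁆) z1 =
      T.mProj ⁅(T.mProj ⁅(z1 : L), (z2 : L)⁆ : L), (z3 : L)⁆ +
        T.mu (T.kProj ⁅(z1 : L), (z2 : L)⁆) z3 +
      (T.mProj ⁅(z2 : L), (T.mProj ⁅(z1 : L), (z3 : L)⁆ : L)⁆ -
        T.mu (T.kProj ⁅(z1 : L), (z3 : L)⁆) z2) := by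
  have key : ∀ a b c : T.m, ⁅(a : L), ⁅(b : L), (c : L)⁆⁆ =
      ⁅(a : L), (T.mProj ⁅(b : L), (c : L)⁆ : L)⁆ -
        (T.mu (T.kProj ⁅(b : L), (c : L)⁆) a : L) := by
    intro a b c
    conv_lhs => rw [T.decomp_lie b c]
    rw [lie_add, coe_mu, ← lie_skew]
    abel
  have key' : ∀ a b c : T.m, ⁅⁅(a : L), (b : L)⁆, (c : L)⁆ =
      ⁅(T.mProj ⁅(a : L), (b : L)⁆ : L), (c : L)⁆ +
        (T.mu (T.kProj ⁅(a : L), (b : L)⁆) c : L) := by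
    intro a b c
    conv_lhs => rw [T.decomp_lie a b]
    rw [add_lie, coe_mu]
    abel
  have h := leibniz_lie (z1 : L) (z2 : L) (z3 : L)
  rw [key, key', key] at h
  constructor
  · have h' := congrArg T.kProj h
    simpa only [map_add, map_sub, T.kProj_of_mem_m (Subtype.prop _), sub_zero, add_zero] using h'
  · have h' := congrArg T.mProj h
    simpa only [map_add, map_sub, T.mProj_of_mem_m (Subtype.prop _)] using h'

/-- The `m`-component of the bracket on `m`. -/
noncomputable def om : T.m →ₗ[K] T.m →ₗ[K] T.m :=
  LinearMap.mk₂ K (fun z w => T.mProj ⁅(z : L), (w : L)⁆)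
    (by intros; simp) (by intros; simp) (by intros; simp) (by intros; simp)

/-- The `𝔅`-component of the bracket on `m`. -/
noncomputable def kap : T.m →ₗ[K] T.m →ₗ[K] T.frakB :=
  LinearMap.mk₂ K (fun z w => T.muB (T.kProj ⁅(z : L), (w : L)⁆))
    (by intros; simp) (by intros; simp) (by intros; simp) (by intros; simp)

theorem om_self (z : T.m) : T.om z z = 0 := by simp [om]

theorem kap_self (z : T.m) : T.kap z z = 0 := by simp [kap]

theorem kap_skew (z w : T.m) : T.kap w z = -T.kap z w := by
  have h := T.kap_self (z + w)
  simp only [map_add, LinearMap.add_apply, T.kap_self, zero_add, add_zero] at h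
  exact eq_neg_of_add_eq_zero_left h

theorem om_skew (z w : T.m) : T.om w z = -T.om z w := by
  have h := T.om_self (z + w)
  simp only [map_add, LinearMap.add_apply, T.om_self, zero_add, add_zero] at h
  exact eq_neg_of_add_eq_zero_left h

theorem s_kap (x : T.s) (z w : T.m) : T.kap (T.sAct x z) w = -T.kap z (T.sAct x w) := by
  have h := congrArg T.muB (T.s_kProj x z w)
  rw [map_add, map_zero] at h
  exact eq_neg_of_add_eq_zero_left h

theorem s_om (x : T.s) (z w : T.m) :
    T.sAct x (T.om z w) = T.om (T.sAct x z) w + T.om z (T.sAct x w) :=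
  (T.s_mProj x z w).symm

theorem B_om (y : T.frakB) (z w : T.m) : (y : Module.End K T.m) (T.om z w) =
    T.om ((y : Module.End K T.m) z) w + T.om z ((y : Module.End K T.m) w) :=
  (T.B_brackets y z w).1.symm

theorem B_kap (y : T.frakB) (z w : T.m) : ⁅y, T.kap z w⁆ =
    T.kap ((y : Module.End K T.m) z) w + T.kap z ((y : Module.End K T.m) w) :=
  Subtype.ext (T.B_brackets y z w).2

theorem kap_om (z1 z2 z3 : T.m) :
    T.kap z1 (T.om z2 z3) = T.kap (T.om z1 z2) z3 + T.kap z2 (T.om z1 z3) := by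
  have h := congrArg T.muB (T.jacobi_parts z1 z2 z3).1
  rw [map_add] at h
  exact h

theorem om_om (z1 z2 z3 : T.m) :
    T.om z1 (T.om z2 z3) - (T.kap z2 z3 : Module.End K T.m) z1 =
      T.om (T.om z1 z2) z3 + (T.kap z1 z2 : Module.End K T.m) z3 +
      (T.om z2 (T.om z1 z3) - (T.kap z1 z3 : Module.End K T.m) z2) :=
  (T.jacobi_parts z1 z2 z3).2

theorem sAct_lie (x x' : T.s) (z : T.m) :
    T.sAct ⁅x, x'⁆ z = T.sAct x (T.sAct x' z) - T.sAct x' (T.sAct x z) :=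
  Subtype.ext (lie_lie (x : L) (x' : L) (z : L))

theorem coeB_add (y y' : T.frakB) (z : T.m) : ((y + y' : T.frakB) : Module.End K T.m) z =
    (y : Module.End K T.m) z + (y' : Module.End K T.m) z := rfl

theorem coeB_smul (c : K) (y : T.frakB) (z : T.m) : ((c • y : T.frakB) : Module.End K T.m) z =
    c • (y : Module.End K T.m) z := rfl

theorem coeB_lie (y y' : T.frakB) (z : T.m) : ((⁅y, y'⁆ : T.frakB) : Module.End K T.m) z =
    (y : Module.End K T.m) ((y' : Module.End K T.m) z) -
      (y' : Module.End K T.m) ((y : Module.End K T.m) z) := rfl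

theorem bracket_fst (u v : T.Ext) : (⁅u, v⁆ : T.Ext).1 = ⁅u.1, v.1⁆ := rfl

theorem bracket_snd_fst (u v : T.Ext) : (⁅u, v⁆ : T.Ext).2.1 =
    ⁅u.2.1, v.2.1⁆ + T.kap u.2.2 v.2.2 := rfl

theorem bracket_snd_snd (u v : T.Ext) : (⁅u, v⁆ : T.Ext).2.2 =
    T.sAct u.1 v.2.2 - T.sAct v.1 u.2.2 + (u.2.1 : Module.End K T.m) v.2.2
       - (v.2.1 : Module.End K T.m) u.2.2 + T.om u.2.2 v.2.2 := rfl

theorem add_fst (u v : T.Ext) : (u + v).1 = u.1 + v.1 := rfl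

theorem add_snd_fst (u v : T.Ext) : (u + v).2.1 = u.2.1 + v.2.1 := rfl

theorem add_snd_snd (u v : T.Ext) : (u + v).2.2 = u.2.2 + v.2.2 := rfl

theorem ext_components {u v : T.Ext} (h1 : u.1 = v.1) (h2 : u.2.1 = v.2.1)
    (h3 : u.2.2 = v.2.2) : u = v :=
  Prod.ext h1 (Prod.ext h2 h3)

theorem leibniz_B (x1 x2 x3 : T.s) (y1 y2 y3 : T.frakB) (z1 z2 z3 : T.m) :
    ⁅y1, ⁅y2, y3⁆ + T.kap z2 z3⁆ +
        T.kap z1 (T.sAct x2 z3 - T.sAct x3 z2 + (y2 : Module.End K T.m) z3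
          - (y3 : Module.End K T.m) z2 + T.om z2 z3) =
      ⁅⁅y1, y2⁆ + T.kap z1 z2, y3⁆ +
        T.kap (T.sAct x1 z2 - T.sAct x2 z1 + (y1 : Module.End K T.m) z2
          - (y2 : Module.End K T.m) z1 + T.om z1 z2) z3 +
      (⁅y2, ⁅y1, y3⁆ + T.kap z1 z3⁆ +
        T.kap z2 (T.sAct x1 z3 - T.sAct x3 z1 + (y1 : Module.End K T.m) z3
          - (y3 : Module.End K T.m) z1 + T.om z1 z3)) := by
  have h1 : T.kap z2 (T.sAct x3 z1) = T.kap z1 (T.sAct x3 z2) := by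
    rw [T.kap_skew (T.sAct x3 z1) z2, T.s_kap, neg_neg]
  have h2 : T.kap z2 ((y3 : Module.End K T.m) z1) = -T.kap ((y3 : Module.End K T.m) z1) z2 :=
    T.kap_skew _ _
  have h3 := T.kap_om z1 z2 z3
  rw [lie_add, add_lie, lie_add, ← lie_skew (T.kap z1 z2) y3, leibniz_lie y1 y2 y3,
    B_kap, B_kap, B_kap]
  simp only [map_add, map_sub, LinearMap.add_apply, LinearMap.sub_apply]
  simp only [h3, T.s_kap x1, T.s_kap x2, h1, h2]
  abel

set_option maxHeartbeats 800000 in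
theorem leibniz_m (x1 x2 x3 : T.s) (y1 y2 y3 : T.frakB) (z1 z2 z3 : T.m) :
    T.sAct x1 (T.sAct x2 z3 - T.sAct x3 z2 + (y2 : Module.End K T.m) z3
          - (y3 : Module.End K T.m) z2 + T.om z2 z3) - T.sAct ⁅x2, x3⁆ z1 +
        (y1 : Module.End K T.m) (T.sAct x2 z3 - T.sAct x3 z2 + (y2 : Module.End K T.m) z3
          - (y3 : Module.End K T.m) z2 + T.om z2 z3) -
        ((⁅y2, y3⁆ + T.kap z2 z3 : T.frakB) : Module.End K T.m) z1 +
        T.om z1 (T.sAct x2 z3 - T.sAct x3 z2 + (y2 : Module.End K T.m) z3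
          - (y3 : Module.End K T.m) z2 + T.om z2 z3) =
      T.sAct ⁅x1, x2⁆ z3 - T.sAct x3 (T.sAct x1 z2 - T.sAct x2 z1 + (y1 : Module.End K T.m) z2
          - (y2 : Module.End K T.m) z1 + T.om z1 z2) +
        ((⁅y1, y2⁆ + T.kap z1 z2 : T.frakB) : Module.End K T.m) z3 -
        (y3 : Module.End K T.m) (T.sAct x1 z2 - T.sAct x2 z1 + (y1 : Module.End K T.m) z2
          - (y2 : Module.End K T.m) z1 + T.om z1 z2) +
        T.om (T.sAct x1 z2 - T.sAct x2 z1 + (y1 : Module.End K T.m) z2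
          - (y2 : Module.End K T.m) z1 + T.om z1 z2) z3 +
      (T.sAct x2 (T.sAct x1 z3 - T.sAct x3 z1 + (y1 : Module.End K T.m) z3
          - (y3 : Module.End K T.m) z1 + T.om z1 z3) - T.sAct ⁅x1, x3⁆ z2 +
        (y2 : Module.End K T.m) (T.sAct x1 z3 - T.sAct x3 z1 + (y1 : Module.End K T.m) z3
          - (y3 : Module.End K T.m) z1 + T.om z1 z3) -
        ((⁅y1, y3⁆ + T.kap z1 z3 : T.frakB) : Module.End K T.m) z2 +
        T.om z2 (T.sAct x1 z3 - T.sAct x3 z1 + (y1 : Module.End K T.m) z3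
          - (y3 : Module.End K T.m) z1 + T.om z1 z3)) := by
  have h := T.om_om z1 z2 z3
  rw [sub_eq_iff_eq_add] at h
  have h1 : T.om z2 (T.sAct x3 z1) = -T.om (T.sAct x3 z1) z2 := T.om_skew _ _
  have h2 : T.om z2 ((y3 : Module.End K T.m) z1) = -T.om ((y3 : Module.End K T.m) z1) z2 :=
    T.om_skew _ _
  rw [coeB_add, coeB_add, coeB_add, coeB_lie, coeB_lie, coeB_lie, sAct_lie, sAct_lie, sAct_lie]
  simp only [map_add, map_sub, LinearMap.add_apply, LinearMap.sub_apply]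
  simp only [h, s_om, B_om, B_sAct, h1, h2]
  abel

noncomputable instance : LieRing T.Ext where
  add_lie u v w := by
    refine T.ext_components ?_ ?_ ?_
    · simp only [bracket_fst, add_fst, add_lie]
    · simp only [bracket_snd_fst, add_snd_fst, add_snd_snd, add_lie, map_add,
        LinearMap.add_apply]
      abel
    · simp only [bracket_snd_snd, add_snd_fst, add_snd_snd, add_fst, coeB_add, map_add,
        LinearMap.add_apply]
      abel
  lie_add u v w := by
    refine T.ext_components ?_ ?_ ?_
    · simp only [bracket_fst, add_fst, lie_add]
    · simp only [bracket_snd_fst, add_snd_fst, add_snd_snd, lie_add, map_add]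
      abel
    · simp only [bracket_snd_snd, add_snd_fst, add_snd_snd, add_fst, coeB_add, map_add,
        LinearMap.add_apply]
      abel
  lie_self u := by
    refine T.ext_components ?_ ?_ ?_
    · simp only [bracket_fst, lie_self]; rfl
    · simp only [bracket_snd_fst, lie_self, kap_self, add_zero]; rfl
    · simp only [bracket_snd_snd, om_self, add_zero, sub_self, zero_add]; rfl
  leibniz_lie u v w := by
    refine T.ext_components ?_ ?_ ?_
    · simp only [bracket_fst, add_fst, leibniz_lie u.1 v.1 w.1]
    · exact T.leibniz_B ..
    · exact T.leibniz_m ..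

noncomputable instance : LieAlgebra K T.Ext where
  lie_smul c u v := by
    have e1 : (c • v).1 = c • v.1 := rfl
    have e2 : (c • v).2.1 = c • v.2.1 := rfl
    have e3 : (c • v).2.2 = c • v.2.2 := rfl
    refine T.ext_components ?_ ?_ ?_
    · exact lie_smul c u.1 v.1
    · change _ = c • (⁅u, v⁆ : T.Ext).2.1
      simp only [bracket_snd_fst, e2, e3, lie_smul, map_smul, smul_add]
    · change _ = c • (⁅u, v⁆ : T.Ext).2.2
      simp only [bracket_snd_snd, e1, e2, e3, coeB_smul,
        map_smul, smul_add, smul_sub, LinearMap.smul_apply]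

end GammaTriple

/-- A Lie algebra is complete if its center is trivial and all its derivations are inner. -/
def IsCompleteLieAlgebra (K : Type u) (L : Type v) [Field K] [LieRing L] [LieAlgebra K L] : Prop :=
  LieAlgebra.center K L = ⊥ ∧ ∀ D : LieDerivation K L L, ∃ x : L, ∀ y : L, D y = ⁅x, y⁆

end Triple
end GammaDecomp

/-! The completeness of `s ⊕ 𝔅 ⊕ m` rests on the structure of `Γ`. The bracket of two elements of
`e(ad L)` is an inner derivation (`lie_algebraicHull_ad_mem`), so the ideal `gammaRad` of those `γ ∈
Γ` that map `L` into its radical is solvable. As `Γ` acts faithfully and completely reducibly on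
`L`, this ideal is central in `Γ` and acts by semisimple endomorphisms. Derivations of the
semisimple algebra `s` are inner, hence `Γ = ad s + gammaRad`. Restricting `gammaRad` to `m` gives a
set `torus` of semisimple central elements of `𝔅`. From `L^Γ = k` and `m = Γ · rad L`, a vector of
`m` killed by `s` and `torus` is zero, and `m` is spanned by `s · m` and `torus · m`. The vanishing
of the center follows at once.

Given a derivation `D`, Whitehead's first lemma makes `D` vanish on `s` after an inner correction.
The `m`-component of `D` on `torus` is then a cocycle of commuting semisimple endomorphisms of `m^s`
without common kernel, hence a coboundary, and a second inner correction removes it. Now `D` maps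
`𝔅` into `𝔅`, and `D(m)` has no `𝔅`-component because `s` and `torus` centralize `𝔅`. Its
`s`-component vanishes by a higher derivation argument: the `s`-components of `D(rad L)` form an
ideal of `s`, and Leibniz's formula for the powers of `D` makes it solvable.

So `D` induces `y ∈ gl(m)`. For `t ∈ torus`, `[t, y] = -D(t)` lies in `𝔅` and commutes with `t`;
semisimplicity of `t` gives `[t, y] = 0`. Thus `y` commutes with `Γ`. As `μ` is injective, `L`
embeds in `s ⊕ 𝔅 ⊕ m`, and `D` restricts to a derivation of `n̂` extending `y`; hence `y ∈ 𝔅` and `D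
= ad y`. -/

namespace GammaDecomp

/-! ### Algebraicity of the Lie algebra of all `X` with `[X, U] ⊆ W`. -/

section Conjugation

variable {K : Type u} [Field K] {ι : Type} [Fintype ι] [DecidableEq ι]

/-- The extension of a linear form on matrices over `K` to matrices over a `K`-algebra `R`. -/
def extendForm (f : Module.Dual K (Matrix ι ι K)) (R : Type*) [CommRing R] [Algebra K R] :
    Matrix ι ι R →ₗ[R] R where
  toFun M := ∑ i, ∑ j, algebraMap K R (f (Matrix.single i j 1)) * M i j
  map_add' M N := by simp [mul_add, Finset.sum_add_distrib]
  map_smul' c M := by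
    simp only [Matrix.smul_apply, smul_eq_mul, RingHom.id_apply, Finset.mul_sum]
    refine Finset.sum_congr rfl fun i _ => Finset.sum_congr rfl fun j _ => ?_
    ring

theorem extendForm_apply (f : Module.Dual K (Matrix ι ι K)) (R : Type*) [CommRing R] [Algebra K R]
    (M : Matrix ι ι R) :
    extendForm f R M = ∑ i, ∑ j, algebraMap K R (f (Matrix.single i j 1)) * M i j := rfl

theorem extendForm_map (f : Module.Dual K (Matrix ι ι K)) {R S : Type*} [CommRing R] [Algebra K R]
    [CommRing S] [Algebra K S] (φ : R →ₐ[K] S) (M : Matrix ι ι R) :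
    extendForm f S (M.map φ) = φ (extendForm f R M) := by
  simp [extendForm_apply]

theorem extendForm_self (f : Module.Dual K (Matrix ι ι K)) (M : Matrix ι ι K) :
    extendForm f K M = f M := by
  conv_rhs => rw [Matrix.matrix_eq_sum_single M]
  simp only [map_sum, extendForm_apply, Algebra.algebraMap_self, RingHom.id_apply]
  refine Finset.sum_congr rfl fun i _ => Finset.sum_congr rfl fun j _ => ?_
  rw [show Matrix.single i j (M i j) = M i j • Matrix.single i j (1 : K) by simp, map_smul,
    smul_eq_mul, mul_comm]

theorem extendForm_algebraMap (f : Module.Dual K (Matrix ι ι K)) (R : Type*) [CommRing R]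
    [Algebra K R] (M : Matrix ι ι K) :
    extendForm f R (M.map (algebraMap K R)) = algebraMap K R (f M) := by
  have := extendForm_map f (Algebra.ofId K R) M
  rw [extendForm_self] at this
  exact this

/-- A matrix over `R` at which all linear forms vanishing on `W` vanish is an `R`-combination of
elements of `W`. -/
theorem mem_span_of_extendForm_eq_zero (W : Submodule K (Matrix ι ι K)) (R : Type*) [CommRing R]
    [Algebra K R] (M : Matrix ι ι R) (hM : ∀ f ∈ W.dualAnnihilator, extendForm f R M = 0) :
    M ∈ Submodule.span R ((fun w : Matrix ι ι K => w.map (algebraMap K R)) '' W) := by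
  obtain ⟨p, hp⟩ := W.exists_isCompl
  let π : Matrix ι ι K →ₗ[K] Matrix ι ι K := W.subtype ∘ₗ W.projectionOnto p hp
  have hπW : ∀ x, π x ∈ W := fun x => Subtype.prop _
  have hπ : ∀ w ∈ W, π w = w := fun w hw => by
    simp [π, Submodule.projectionOnto_apply_of_mem_left hp hw]
  -- The matrix units may be replaced by their projections to `W`: each entry of `id - π` is a
  -- linear form vanishing on `W`, so its extension vanishes at `M`.
  have key : M = ∑ i, ∑ j, M i j • (π (Matrix.single i j 1)).map (algebraMap K R) := by
    ext r s
    let f : Module.Dual K (Matrix ι ι K) :=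
      (Matrix.entryLinearMap K K r s) ∘ₗ (LinearMap.id - π)
    have hf : f ∈ W.dualAnnihilator := by
      rw [Submodule.mem_dualAnnihilator]
      intro w hw
      simp [f, hπ w hw]
    have h := hM f hf
    have hfs : ∀ i j, f (Matrix.single i j 1) =
        (Matrix.single i j (1 : K)) r s - π (Matrix.single i j 1) r s := fun i j => rfl
    simp only [extendForm_apply, hfs, map_sub, sub_mul, Finset.sum_sub_distrib, sub_eq_zero] at h
    simp only [Matrix.sum_apply, Matrix.smul_apply, Matrix.map_apply, smul_eq_mul]
    have h2 : M r s = ∑ i, ∑ j, algebraMap K R (Matrix.single i j (1 : K) r s) * M i j := by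
      simp [Matrix.single_apply, ite_and, apply_ite (algebraMap K R), ite_mul]
    rw [h2, h]
    simp only [mul_comm]
  rw [key]
  refine Submodule.sum_mem _ fun i _ => Submodule.sum_mem _ fun j _ => Submodule.smul_mem _ _ ?_
  exact Submodule.subset_span ⟨_, hπW _, rfl⟩

/-- The polynomial expressing that the linear form `f` vanishes at
`det X • (X * E * X⁻¹ - E)`. -/
noncomputable def conjPoly (E : Matrix ι ι K) (f : Module.Dual K (Matrix ι ι K)) :
    MvPolynomial (ι × ι) K :=
  extendForm f (MvPolynomial (ι × ι) K)
    (Matrix.mvPolynomialX ι ι K * E.map (algebraMap K _) * (Matrix.mvPolynomialX ι ι K).adjugate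
      - (Matrix.mvPolynomialX ι ι K).det • E.map (algebraMap K _))

theorem aeval_conjPoly (E : Matrix ι ι K) (f : Module.Dual K (Matrix ι ι K)) {R : Type*}
    [CommRing R] [Algebra K R] (A : Matrix ι ι R) :
    MvPolynomial.aeval (fun p : ι × ι => A p.1 p.2) (conjPoly E f) =
      extendForm f R (A * E.map (algebraMap K R) * A.adjugate
        - A.det • E.map (algebraMap K R)) := by
  rw [conjPoly, ← extendForm_map]
  congr 1
  set φ : MvPolynomial (ι × ι) K →ₐ[K] R := MvPolynomial.aeval (fun p : ι × ι => A p.1 p.2) with hφ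
  have hX : (Matrix.mvPolynomialX ι ι K).map φ = A := by
    ext i j; simp [φ]
  have hE : (E.map (algebraMap K (MvPolynomial (ι × ι) K))).map φ = E.map (algebraMap K R) := by
    ext i j
    simp only [Matrix.map_apply, AlgHom.commutes]
  have hadj : (Matrix.mvPolynomialX ι ι K).adjugate.map φ = A.adjugate := by
    have := AlgHom.map_adjugate φ (Matrix.mvPolynomialX ι ι K)
    rw [AlgHom.mapMatrix_apply, AlgHom.mapMatrix_apply, hX] at this
    exact this
  have hdet : φ (Matrix.mvPolynomialX ι ι K).det = A.det := by
    rw [AlgHom.map_det, AlgHom.mapMatrix_apply, hX]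
  have hsm : ((Matrix.mvPolynomialX ι ι K).det • E.map (algebraMap K (MvPolynomial (ι × ι) K))).map
      φ = A.det • E.map (algebraMap K R) := by
    rw [← hdet, ← hE]
    ext i j
    simp
  rw [Matrix.map_sub φ (map_sub φ), Matrix.map_mul, Matrix.map_mul, hX, hE, hadj, hsm]

/-- The equations for `X * E * X⁻¹ - E ∈ W` for all `E ∈ U`. -/
def conjEquations (U W : Submodule K (Matrix ι ι K)) : Set (MvPolynomial (ι × ι) K) :=
  {P | ∃ E ∈ U, ∃ f ∈ W.dualAnnihilator, P = conjPoly E f}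

/-- Since `adj A = det A • A⁻¹` with `det A` a unit, multiplying by the determinant to obtain
polynomial equations does not change the solutions in `GL`. -/
theorem isZeroOf_conjEquations_iff (U W : Submodule K (Matrix ι ι K)) {R : Type u} [CommRing R]
    [Algebra K R] (A : Matrix.GeneralLinearGroup ι R) :
    IsZeroOf (conjEquations U W) A.val ↔
      ∀ E ∈ U, ∀ f ∈ W.dualAnnihilator,
        extendForm f R (A.val * E.map (algebraMap K R) * (A⁻¹).val - E.map (algebraMap K R)) = 0 := by
  have hadj : A.val.adjugate = A.val.det • (A⁻¹).val := by
    have h : A.val.adjugate = A.val.adjugate * (A.val * (A⁻¹).val) := by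
      rw [← Units.val_mul, mul_inv_cancel, Units.val_one, mul_one]
    rw [h, ← mul_assoc, Matrix.adjugate_mul, Matrix.smul_mul, one_mul]
  have hu : IsUnit A.val.det := (Matrix.isUnit_iff_isUnit_det _).1 A.isUnit
  have key : ∀ E f, MvPolynomial.aeval (fun p : ι × ι => A.val p.1 p.2) (conjPoly E f) =
      A.val.det * extendForm f R (A.val * E.map (algebraMap K R) * (A⁻¹).val
        - E.map (algebraMap K R)) := by
    intro E f
    rw [aeval_conjPoly, hadj, Matrix.mul_smul, ← smul_sub, map_smul, smul_eq_mul]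
  constructor
  · intro h E hE f hf
    have := h _ ⟨E, hE, f, hf, rfl⟩
    rw [key] at this
    exact (hu.mul_right_eq_zero).1 this
  · rintro h _ ⟨E, hE, f, hf, rfl⟩
    rw [key, h E hE f hf, mul_zero]

/-- The equations say that conjugation by `A` is the identity on `U` modulo `W`, after extension of
scalars. As `W ≤ U`, such an `A` stabilizes the extension of `W`, which gives closure under
products; inverses need that only `W` is carried into `W`. -/
theorem isAlgebraicGroup_conjEquations (U W : Submodule K (Matrix ι ι K)) (hWU : W ≤ U) :
    IsAlgebraicGroup (conjEquations U W) := by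
  intro R _ _
  let WR : Submodule R (Matrix ι ι R) :=
    { carrier := {M | ∀ f ∈ W.dualAnnihilator, extendForm f R M = 0}
      add_mem' := fun ha hb f hf => by rw [map_add, ha f hf, hb f hf, add_zero]
      zero_mem' := fun f _ => map_zero _
      smul_mem' := fun c x hx f hf => by rw [map_smul, hx f hf, smul_zero] }
  let conj (A : Matrix.GeneralLinearGroup ι R) : Matrix ι ι R →ₗ[R] Matrix ι ι R :=
    LinearMap.mulLeft R A.val ∘ₗ LinearMap.mulRight R (A⁻¹).val
  have hconj : ∀ A M, conj A M = A.val * M * (A⁻¹).val := fun A M => by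
    simp [conj, mul_assoc]
  have hconj_mul : ∀ A B M, conj (A * B) M = conj A (conj B M) := fun A B M => by
    simp only [hconj, mul_inv_rev, Units.val_mul, mul_assoc]
  have hconj_one : ∀ M, conj 1 M = M := fun M => by simp [hconj]
  have hmapW : ∀ w ∈ W, w.map (algebraMap K R) ∈ WR := fun w hw f hf => by
    rw [extendForm_algebraMap, (Submodule.mem_dualAnnihilator f).1 hf w hw, map_zero]
  let P (A : Matrix.GeneralLinearGroup ι R) : Prop :=
    ∀ E ∈ U, conj A (E.map (algebraMap K R)) - E.map (algebraMap K R) ∈ WR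
  have hP : ∀ A, P A ↔ IsZeroOf (conjEquations U W) A.val := fun A => by
    rw [isZeroOf_conjEquations_iff]
    simp only [P, hconj]
    rfl
  have hWR : ∀ A, P A → WR ≤ WR.comap (conj A) := by
    intro A hA M hM
    have hM' := mem_span_of_extendForm_eq_zero W R M hM
    have hle : Submodule.span R ((fun w : Matrix ι ι K => w.map (algebraMap K R)) '' W) ≤
        WR.comap (conj A) := by
      rw [Submodule.span_le]
      rintro _ ⟨w, hw, rfl⟩
      have := add_mem (hA w (hWU hw)) (hmapW w hw)
      rwa [sub_add_cancel] at this
    exact hle hM'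
  have hinvWR : ∀ A, P A → ∀ M, conj A M ∈ WR → M ∈ WR := by
    intro A hA M hM
    let q : (Matrix ι ι R ⧸ WR) →ₗ[R] (Matrix ι ι R ⧸ WR) := WR.mapQ WR (conj A) (hWR A hA)
    have hsurj : Function.Surjective q := by
      intro y
      obtain ⟨y, rfl⟩ := WR.mkQ_surjective y
      refine ⟨WR.mkQ (conj A⁻¹ y), ?_⟩
      rw [Submodule.mkQ_apply, Submodule.mapQ_apply, ← hconj_mul, mul_inv_cancel, hconj_one]
      rfl
    -- No dimension count is available over a general ring `R`; instead, a surjective endomorphism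
    -- of a finitely generated module is injective.
    have hinj : Function.Injective q := OrzechProperty.injective_of_surjective_endomorphism q hsurj
    have h0 : q (WR.mkQ M) = 0 := by
      rw [Submodule.mkQ_apply, Submodule.mapQ_apply]
      exact (Submodule.Quotient.mk_eq_zero WR).2 hM
    exact (Submodule.Quotient.mk_eq_zero WR).1 (hinj (h0.trans (map_zero q).symm))
  refine ⟨{ carrier := {A | P A}, mul_mem' := ?_, one_mem' := ?_, inv_mem' := ?_ }, hP⟩
  · intro A B hA hB E hE
    have h1 := hWR A hA (hB E hE)
    rw [Submodule.mem_comap, map_sub] at h1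
    have h2 := add_mem h1 (hA E hE)
    rwa [sub_add_sub_cancel, ← hconj_mul] at h2
  · intro E _
    rw [hconj_one, sub_self]
    exact zero_mem _
  · intro A hA E hE
    refine hinvWR A hA _ ?_
    rw [map_sub, ← hconj_mul, mul_inv_cancel, hconj_one, ← neg_sub]
    exact neg_mem (hA E hE)

/-- Because `(εX)² = 0`, the inverse of `1 + εX` is `1 - εX`, and `(1 + εX) E (1 - εX) - E = ε (XE -
EX)`. -/
theorem isTangent_conjEquations_iff (U W : Submodule K (Matrix ι ι K)) (X : Matrix ι ι K) :
    IsTangent (conjEquations U W) X ↔ ∀ E ∈ U, X * E - E * X ∈ W := by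
  set εX : Matrix ι ι (DualNumber K) := X.map (TrivSqZeroExt.inr : K → DualNumber K) with hε
  have hsq : εX * εX = 0 := by
    ext i j <;> simp [εX, Matrix.mul_apply]
  have h1 : (1 + εX) * (1 - εX) = 1 := by
    rw [mul_sub, add_mul, mul_one, add_mul, hsq]; simp
  have h2 : (1 - εX) * (1 + εX) = 1 := by
    rw [mul_add, sub_mul, mul_one, sub_mul, hsq]; simp
  let A : Matrix.GeneralLinearGroup ι (DualNumber K) := ⟨1 + εX, 1 - εX, h1, h2⟩
  have hA : IsTangent (conjEquations U W) X ↔ IsZeroOf (conjEquations U W) A.val := Iff.rfl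
  have hval : ∀ E : Matrix ι ι K, A.val * E.map (algebraMap K (DualNumber K)) * (A⁻¹).val -
      E.map (algebraMap K (DualNumber K)) =
      (TrivSqZeroExt.inr (1 : K) : DualNumber K) •
        (X * E - E * X).map (algebraMap K (DualNumber K)) := by
    intro E
    have e1 : εX * E.map (algebraMap K (DualNumber K)) =
        (TrivSqZeroExt.inr (1 : K) : DualNumber K) • (X * E).map (algebraMap K (DualNumber K)) := by
      ext i j <;> simp [εX, Matrix.mul_apply, TrivSqZeroExt.algebraMap_eq_inl,
        TrivSqZeroExt.fst_sum, TrivSqZeroExt.snd_sum, mul_comm]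
    have e2 : E.map (algebraMap K (DualNumber K)) * εX =
        (TrivSqZeroExt.inr (1 : K) : DualNumber K) • (E * X).map (algebraMap K (DualNumber K)) := by
      ext i j <;> simp [εX, Matrix.mul_apply, TrivSqZeroExt.algebraMap_eq_inl,
        TrivSqZeroExt.fst_sum, TrivSqZeroExt.snd_sum, mul_comm]
    have e3 : εX * E.map (algebraMap K (DualNumber K)) * εX = 0 := by
      rw [mul_assoc, e2, Matrix.mul_smul]
      ext i j <;> simp [εX, Matrix.mul_apply, TrivSqZeroExt.algebraMap_eq_inl,
        TrivSqZeroExt.fst_sum, TrivSqZeroExt.snd_sum]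
    have hAv : A.val = 1 + εX := rfl
    have hAi : (A⁻¹).val = 1 - εX := rfl
    rw [hAv, hAi, Matrix.map_sub _ (map_sub _), smul_sub, ← e1, ← e2, mul_sub, mul_one, add_mul,
      one_mul, add_mul, e3]
    abel
  rw [hA, isZeroOf_conjEquations_iff]
  have key : ∀ (E : Matrix ι ι K) (f : Module.Dual K (Matrix ι ι K)),
      extendForm f (DualNumber K) (A.val * E.map (algebraMap K (DualNumber K)) * (A⁻¹).val -
        E.map (algebraMap K (DualNumber K))) = TrivSqZeroExt.inr (f (X * E - E * X)) := by
    intro E f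
    rw [hval, map_smul, extendForm_algebraMap, TrivSqZeroExt.algebraMap_eq_inl, smul_eq_mul,
      TrivSqZeroExt.inr_mul_inl]
    simp
  simp only [key]
  refine forall₂_congr fun E _ => ?_
  rw [← Subspace.forall_mem_dualAnnihilator_apply_eq_zero_iff W]
  refine forall₂_congr fun f _ => ?_
  exact ⟨fun h => TrivSqZeroExt.inr_injective (h.trans (TrivSqZeroExt.inr_zero K).symm),
    fun h => by rw [h, TrivSqZeroExt.inr_zero]⟩

variable {V : Type v} [AddCommGroup V] [Module K V] [FiniteDimensional K V]

/-- The Lie algebra of the endomorphisms `X` with `[X, U] ⊆ W`. -/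
def transporter (U W : Submodule K (Module.End K V)) (hWU : W ≤ U) :
    LieSubalgebra K (Module.End K V) where
  carrier := {X | ∀ E ∈ U, ⁅X, E⁆ ∈ W}
  add_mem' ha hb E hE := by rw [add_lie]; exact add_mem (ha E hE) (hb E hE)
  zero_mem' E _ := by rw [zero_lie]; exact zero_mem _
  smul_mem' c X hX E hE := by rw [smul_lie]; exact W.smul_mem c (hX E hE)
  lie_mem' := by
    intro X Y hX hY E hE
    rw [lie_lie]
    exact sub_mem (hX _ (hWU (hY E hE))) (hY _ (hWU (hX E hE)))

theorem isAlgebraic_transporter (U W : Submodule K (Module.End K V)) (hWU : W ≤ U) :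
    IsAlgebraic (transporter U W hWU) := by
  classical
  set Φ := LinearMap.toMatrix (Module.finBasis K V) (Module.finBasis K V) with hΦ
  refine ⟨conjEquations (U.map Φ.toLinearMap) (W.map Φ.toLinearMap),
    isAlgebraicGroup_conjEquations _ _ (Submodule.map_mono hWU), fun X => ?_⟩
  rw [isTangent_conjEquations_iff]
  have hlie : ∀ E, Φ X * Φ E - Φ E * Φ X = Φ ⁅X, E⁆ := fun E => by
    rw [Ring.lie_def, map_sub, hΦ, LinearMap.toMatrix_mul, LinearMap.toMatrix_mul]
  constructor
  · rintro h _ ⟨E, hE, rfl⟩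
    exact ⟨_, h E hE, (hlie E).symm⟩
  · intro h E hE
    obtain ⟨Y, hY, hY'⟩ := h _ ⟨E, hE, rfl⟩
    have : Φ Y = Φ ⁅X, E⁆ := hY'.trans (hlie E)
    rw [← Φ.injective this]
    exact hY

end Conjugation

/-! ### Commutators in the algebraic hull of `ad L`. -/

section AdHull

variable {K : Type u} [Field K] {L : Type v} [LieRing L] [LieAlgebra K L] [FiniteDimensional K L]

theorem le_algebraicHull (M : LieSubalgebra K (Module.End K L)) : M ≤ algebraicHull M :=
  le_sInf fun _ h => h.2

/-- The derived algebra of the algebraic hull of `ad L` consists of inner derivations. -/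
theorem lie_algebraicHull_ad_mem {X Y : Module.End K L}
    (hX : X ∈ algebraicHull (LieAlgebra.ad K L).range)
    (hY : Y ∈ algebraicHull (LieAlgebra.ad K L).range) :
    ⁅X, Y⁆ ∈ (LieAlgebra.ad K L).range := by
  have hder : algebraicHull (LieAlgebra.ad K L).range ≤ derSubalgebra K L := by
    refine algebraicHull_le (isAlgebraic_derSubalgebra K L) ?_
    rintro _ ⟨a, rfl⟩ x y
    simp
  have hle : (LieAlgebra.ad K L).range.toSubmodule ≤
      (algebraicHull (LieAlgebra.ad K L).range).toSubmodule := le_algebraicHull _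
  -- The `X` with `[X, e(ad L)] ⊆ ad L` form an algebraic Lie algebra. It contains `ad L`, since
  -- `[ad a, Z] = -ad (Z a)` for a derivation `Z`, so it contains the hull.
  refine algebraicHull_le (isAlgebraic_transporter _ _ hle) ?_ hX Y hY
  rintro _ ⟨a, rfl⟩ Z hZ
  have hZ' := hder hZ
  refine ⟨-Z a, ?_⟩
  ext x
  have := hZ' a x
  simp [Ring.lie_def, this]

end AdHull

end GammaDecomp

namespace GammaDecomp

/-! ### Lie algebras with a faithful completely reducible module. -/

section CompletelyReducible

/-- An endomorphism `u` is nilpotent if `tr (q u) = 0` for all polynomials `q` without constant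
term. -/
theorem isNilpotent_of_trace_mul_aeval_eq_zero {K : Type u} [Field K] [CharZero K] {V : Type v}
    [AddCommGroup V] [Module K V] [FiniteDimensional K V] (f : Module.End K V)
    (h : ∀ q : Polynomial K, LinearMap.trace K V (f * Polynomial.aeval f q) = 0) :
    IsNilpotent f := by
  obtain ⟨g, hg, hX⟩ := Polynomial.exists_eq_pow_rootMultiplicity_mul_and_not_dvd (minpoly K f)
    (minpoly.ne_zero_of_finite K f) 0
  set k := (minpoly K f).rootMultiplicity 0
  rw [Polynomial.C_0, sub_zero] at hg hX
  have hcop : IsCoprime ((Polynomial.X : Polynomial K) ^ (k + 1)) g :=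
    ((Polynomial.irreducible_X.coprime_iff_not_dvd).2 hX).pow_left
  -- The element `e = a(f) f^(k+1)` is the projection onto the Fitting component on which `f` is
  -- invertible. The exponent `k + 1` ensures that `e` is a multiple of `f` even when `k = 0`, so
  -- the hypothesis gives `tr e = 0`; in characteristic zero an idempotent of trace zero is zero.
  obtain ⟨a, b, hab⟩ := hcop
  set e := Polynomial.aeval f (a * Polynomial.X ^ (k + 1)) with he
  have hmin : Polynomial.aeval f (Polynomial.X ^ k * g) = 0 := by rw [← hg, minpoly.aeval]
  have hidem : IsIdempotentElem e := by
    have h1 : a * Polynomial.X ^ (k + 1) * (a * Polynomial.X ^ (k + 1)) =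
        a * Polynomial.X ^ (k + 1) - (a * b * Polynomial.X) * (Polynomial.X ^ k * g) := by
      linear_combination (a * Polynomial.X ^ (k + 1)) * hab
    rw [IsIdempotentElem, he, ← map_mul, h1, map_sub, map_mul _ (a * b * Polynomial.X), hmin,
      mul_zero, sub_zero]
  have htr : LinearMap.trace K V e = 0 := by
    have h1 : a * Polynomial.X ^ (k + 1) = Polynomial.X * (a * Polynomial.X ^ k) := by ring
    rw [he, h1, map_mul, Polynomial.aeval_X]
    exact h _
  have he0 : e = 0 := LinearMap.IsIdempotentElem.eq_zero_of_trace_eq_zero hidem htr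
  refine ⟨k, ?_⟩
  have h2 : Polynomial.X ^ k = Polynomial.X ^ k * (a * Polynomial.X ^ (k + 1)) +
      b * (Polynomial.X ^ k * g) := by
    linear_combination (-(Polynomial.X ^ k : Polynomial K)) * hab
  have h3 := congrArg (Polynomial.aeval f) h2
  rw [map_add, map_mul, map_mul _ b, hmin, mul_zero, add_zero, ← he, he0, mul_zero, map_pow,
    Polynomial.aeval_X] at h3
  exact h3

/-- A nilpotent module endomorphism that stabilizes all submodules of a completely reducible
module is zero. -/
theorem eq_zero_of_isNilpotent_of_forall_stable {K : Type u} [Field K] {L : Type*} [LieRing L]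
    {V : Type*} [AddCommGroup V] [Module K V] [LieRingModule L V]
    [ComplementedLattice (LieSubmodule K L V)] {f : Module.End K V} (hf : IsNilpotent f) (hcomm : ∀ (x : L) (v : V), f ⁅x, v⁆ = ⁅x, f v⁆)
    (hst : ∀ W : LieSubmodule K L V, ∀ w ∈ W, f w ∈ W) : f = 0 := by
  let W : LieSubmodule K L V :=
    { LinearMap.ker f with
      lie_mem := by
        intro x v hv
        have h : f v = 0 := hv
        change f ⁅x, v⁆ = 0
        rw [hcomm, h, lie_zero] }
  have hW : ∀ v, v ∈ W ↔ f v = 0 := fun v => Iff.rfl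
  -- On a complement of its kernel, `f` is stable, injective and nilpotent, so the complement is
  -- zero.
  obtain ⟨W', hWW'⟩ := exists_isCompl W
  have hinj : ∀ w ∈ W', f w = 0 → w = 0 := fun w hw h => by
    have : w ∈ W ⊓ W' := ⟨(hW w).2 h, hw⟩
    rwa [hWW'.inf_eq_bot, LieSubmodule.mem_bot] at this
  obtain ⟨n, hn⟩ := hf
  have hpow : ∀ (j : ℕ) (w : V), w ∈ W' → (f ^ j) w = 0 → w = 0 := by
    intro j
    induction j with
    | zero => intro w _ h; exact h
    | succ j ih =>
      intro w hw h
      rw [pow_succ, Module.End.mul_apply] at h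
      exact hinj w hw (ih _ (hst W' w hw) h)
  have hbot : W' = ⊥ := by
    rw [LieSubmodule.eq_bot_iff]
    intro w hw
    exact hpow n w hw (by rw [hn]; rfl)
  have htop : W = ⊤ := by simpa [hbot] using hWW'.sup_eq_top
  ext v
  exact (hW v).1 (htop ▸ LieSubmodule.mem_top v)

variable {K : Type u} [Field K] {L : Type*} [LieRing L] [LieAlgebra K L]
  {V : Type*} [AddCommGroup V] [Module K V] [LieRingModule L V] [LieModule K L V]

/-- If `b` commutes with `w`, then `tr (a b w) = tr (a w b) = tr (b a w)`. -/
theorem trace_toEnd_mul_eq_zero (I J : LieIdeal K L) (w : Module.End K V)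
    (hw : ∀ b ∈ J, Commute (LieModule.toEnd K L V b) w)  {x : L} (hx : x ∈ ⁅I, J⁆) :
    LinearMap.trace K V (LieModule.toEnd K L V x * w) = 0 := by
  replace hx : x ∈ (⁅I, J⁆ : LieIdeal K L).toSubmodule := hx
  rw [LieSubmodule.lieIdeal_oper_eq_linear_span'] at hx
  induction hx using Submodule.span_induction with
  | mem x h =>
    obtain ⟨a, -, b, hb, rfl⟩ := h
    have := (hw b hb).eq
    rw [LieHom.map_lie, Ring.lie_def, sub_mul, map_sub, mul_assoc, mul_assoc, this,
      LinearMap.trace_mul_comm K (LieModule.toEnd K L V b), mul_assoc, sub_self]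
  | zero => simp
  | add x y _ _ hx hy => rw [map_add, add_mul, map_add, hx, hy, add_zero]
  | smul c x _ hx => rw [map_smul, smul_mul_assoc, map_smul, hx, smul_zero]

variable [FiniteDimensional K V]

/-- An ideal acting by nilpotent endomorphisms on a completely reducible module acts trivially. -/
theorem lie_eq_zero_of_forall_isNilpotent [ComplementedLattice (LieSubmodule K L V)]
    (I : LieIdeal K L) (hI : ∀ x ∈ I, IsNilpotent (LieModule.toEnd K L V x)) {x : L} (hx : x ∈ I)
    (v : V) : ⁅x, v⁆ = 0 := by
  let W : LieSubmodule K L V :=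
    { carrier := {v | ∀ x ∈ I, ⁅x, v⁆ = 0}
      add_mem' := fun ha hb x hx => by rw [lie_add, ha x hx, hb x hx, add_zero]
      zero_mem' := fun x _ => lie_zero x
      smul_mem' := fun c v hv x hx => by rw [lie_smul, hv x hx, smul_zero]
      lie_mem := by
        intro y v hv x hx
        have h1 : ⁅x, v⁆ = 0 := hv x hx
        have h2 : ⁅⁅x, y⁆, v⁆ = 0 := hv _ (lie_mem_left K L I x y hx)
        rw [leibniz_lie, h1, h2, lie_zero, add_zero] }
  -- A nonzero complement of the `I`-invariants would, by Engel's theorem, contain a nonzero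
  -- `I`-invariant vector.
  obtain ⟨W', hW⟩ := exists_isCompl W
  have hW' : W' = ⊥ := by
    by_contra hne
    let W'' : LieSubmodule K I V :=
      { W'.toSubmodule with lie_mem := fun {x v} hv => W'.lie_mem (x := (x : L)) hv }
    have hnt : Nontrivial W'' := by
      have hne' : W'.toSubmodule ≠ ⊥ := fun h => hne ((LieSubmodule.toSubmodule_eq_bot W').1 h)
      obtain ⟨w, hw, hw0⟩ := Submodule.exists_mem_ne_zero_of_ne_bot hne'
      exact ⟨⟨⟨w, hw⟩, 0, fun h => hw0 (congrArg Subtype.val h)⟩⟩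
    have hnil : LieModule.IsNilpotent I W'' := by
      rw [LieModule.isNilpotent_iff_forall' (R := K)]
      intro x
      obtain ⟨n, hn⟩ := hI x x.2
      refine ⟨n, ?_⟩
      have hpow : ∀ (j : ℕ) (w : W''), (((LieModule.toEnd K I W'' x) ^ j) w : V) =
          ((LieModule.toEnd K L V x) ^ j) w := by
        intro j
        induction j with
        | zero => intro w; rfl
        | succ j ih => intro w; rw [pow_succ, pow_succ, Module.End.mul_apply, ih]; rfl
      ext w
      rw [hpow, hn]
      rfl
    have hnt' := LieModule.nontrivial_max_triv_of_isNilpotent K I W''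
    obtain ⟨⟨w, hw⟩, hw0⟩ := exists_ne (0 : LieModule.maxTrivSubmodule K I W'')
    have hwW : (w : V) ∈ W := fun x hx => by
      have := (LieModule.mem_maxTrivSubmodule K I W'' w).1 hw ⟨x, hx⟩
      exact congrArg Subtype.val this
    have : (w : V) ∈ W ⊓ W' := ⟨hwW, w.2⟩
    rw [hW.inf_eq_bot, LieSubmodule.mem_bot] at this
    exact hw0 (Subtype.ext (Subtype.ext this))
  have htop : W = ⊤ := by simpa [hW'] using hW.sup_eq_top
  have hv : v ∈ W := htop ▸ LieSubmodule.mem_top v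
  exact hv x hx

/-- `J` commutes with every polynomial in `x`, so all the traces `tr (x q(x))` vanish. -/
theorem isNilpotent_toEnd_of_mem_lie [CharZero K] (I J : LieIdeal K L) {x : L} (hx : x ∈ ⁅I, J⁆)
    (hcomm : ∀ b ∈ J, ⁅b, x⁆ = 0) : IsNilpotent (LieModule.toEnd K L V x) := by
  refine isNilpotent_of_trace_mul_aeval_eq_zero _ fun q => ?_
  refine trace_toEnd_mul_eq_zero I J _ (fun b hb => ?_) hx
  have h1 : Commute (LieModule.toEnd K L V b) (LieModule.toEnd K L V x) := by
    rw [commute_iff_lie_eq, ← LieHom.map_lie, hcomm b hb, map_zero]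
  exact Algebra.commute_of_mem_adjoin_singleton_of_commute
    (Polynomial.aeval_mem_adjoin_singleton K _) h1

variable [CharZero K] [ComplementedLattice (LieSubmodule K L V)]
variable (V)

theorem lie_ideals_eq_bot_of_completely_reducible [LieModule.IsFaithful K L V] (I J : LieIdeal K L)
    (hcomm : ∀ x ∈ ⁅I, J⁆, ∀ b ∈ J, ⁅b, x⁆ = 0) : ⁅I, J⁆ = ⊥ := by
  rw [LieSubmodule.eq_bot_iff]
  intro x hx
  rw [← LieModule.toEnd_eq_zero_iff (R := K) (L := L) (M := V)]
  ext v
  exact lie_eq_zero_of_forall_isNilpotent ⁅I, J⁆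
    (fun y hy => isNilpotent_toEnd_of_mem_lie I J hy (hcomm y hy)) hx v

/-- A Lie algebra with a faithful completely reducible module is reductive. -/
theorem le_center_of_isSolvable [LieModule.IsFaithful K L V] (I : LieIdeal K L)
    [hI : LieAlgebra.IsSolvable I] : I ≤ LieAlgebra.center K L := by
  obtain ⟨n, hn⟩ := (LieAlgebra.isSolvable_iff K I).1 hI
  rw [LieIdeal.derivedSeries_eq_bot_iff] at hn
  clear hI
  induction n generalizing I with
  | zero =>
    rw [LieAlgebra.derivedSeriesOfIdeal_zero] at hn
    rw [hn]
    exact bot_le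
  | succ n ih =>
    rw [LieAlgebra.derivedSeriesOfIdeal_add I n 1, LieAlgebra.derivedSeriesOfIdeal_succ,
      LieAlgebra.derivedSeriesOfIdeal_zero] at hn
    -- By induction `[I, I]` is central. The trace argument then applies twice: to `[I, I]`, giving
    -- zero, and next to `[L, I]`, which lies in the now abelian ideal `I`.
    have h1 := ih _ hn
    have h2 : ⁅I, I⁆ = ⊥ := by
      refine lie_ideals_eq_bot_of_completely_reducible V I I fun x hx b _ => ?_
      exact (LieModule.mem_maxTrivSubmodule K L L x).1 (h1 hx) b
    have h3 : ⁅(⊤ : LieIdeal K L), I⁆ = ⊥ := by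
      refine lie_ideals_eq_bot_of_completely_reducible V ⊤ I fun x hx b hb => ?_
      have hxI : x ∈ I := LieSubmodule.lie_le_right I ⊤ hx
      have := LieSubmodule.lie_mem_lie hb hxI
      rwa [h2, LieSubmodule.mem_bot] at this
    intro x hx
    rw [LieModule.mem_maxTrivSubmodule]
    intro y
    have := LieSubmodule.lie_mem_lie (LieSubmodule.mem_top (R := K) y) hx
    rwa [h3, LieSubmodule.mem_bot] at this

/-- The nilpotent Jordan part of `x` is a polynomial in `x`: it commutes with `L` and stabilizes all
submodules, hence it is zero. -/
theorem isSemisimple_toEnd_of_mem_center {x : L} (hx : x ∈ LieAlgebra.center K L) :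
    (LieModule.toEnd K L V x).IsSemisimple := by
  obtain ⟨n, hn, s, -, hnil, hss, hadd⟩ := (LieModule.toEnd K L V x).exists_isNilpotent_isSemisimple
  have hn0 : n = 0 := by
    refine eq_zero_of_isNilpotent_of_forall_stable (L := L) hnil (fun y v => ?_) fun W w hw => ?_
    · have h1 : Commute (LieModule.toEnd K L V y) (LieModule.toEnd K L V x) := by
        rw [commute_iff_lie_eq, ← LieHom.map_lie, (LieModule.mem_maxTrivSubmodule K L L x).1 hx y,
          map_zero]
      have h2 := Algebra.commute_of_mem_adjoin_singleton_of_commute hn h1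
      exact (LinearMap.congr_fun h2.eq v).symm
    · clear hnil hadd
      induction hn using Algebra.adjoin_induction generalizing w with
      | mem a ha => rw [Set.mem_singleton_iff.1 ha]; exact W.lie_mem hw
      | algebraMap r => exact W.smul_mem r hw
      | add a b _ _ ha hb => exact W.add_mem (ha w hw) (hb w hw)
      | mul a b _ _ ha hb => exact ha _ (hb w hw)
  rw [hadd, hn0, zero_add]
  exact hss

end CompletelyReducible

end GammaDecomp

namespace GammaDecomp

/-! ### Whitehead's first lemma by means of Casimir elements. -/

section Whitehead

/-- The tensor `∑ i, b' i ⊗ b i` of dual bases of an invariant form is invariant. -/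
theorem sum_lie_dualBasis_add {K : Type*} [Field K] {L : Type*} [LieRing L] [LieAlgebra K L]
    {M W : Type*} [AddCommGroup M] [Module K M] [LieRingModule L M] [LieModule K L M]
    [AddCommGroup W] [Module K W] (B : LinearMap.BilinForm K M) (hB : B.Nondegenerate)
    (hinv : B.lieInvariant L) {ι : Type*} [Fintype ι] [DecidableEq ι] (b : Module.Basis ι K M)
    (β : M →ₗ[K] M →ₗ[K] W) (x : L) :
    ∑ i, (β ⁅x, B.dualBasis hB b i⁆ (b i) + β (B.dualBasis hB b i) ⁅x, b i⁆) = 0 := by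
  set d := B.dualBasis hB b with hd
  have hb : ∀ a, a = ∑ j, B (d j) a • b j := by
    intro a
    conv_lhs => rw [← b.sum_repr a]
    refine Finset.sum_congr rfl fun j _ => ?_
    have h : B (d j) a = b.repr a j := by
      conv_lhs => rw [← b.sum_repr a]
      simp only [map_sum, map_smul, hd, LinearMap.BilinForm.apply_dualBasis_left]
      simp
    rw [h]
  have hd' : ∀ a, a = ∑ j, B a (b j) • d j := by
    intro a
    conv_lhs => rw [← d.sum_repr a]
    simp [hd]
  have h1 : ∑ i, β ⁅x, d i⁆ (b i) = ∑ i, ∑ j, B ⁅x, d i⁆ (b j) • β (d j) (b i) := by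
    refine Finset.sum_congr rfl fun i _ => ?_
    conv_lhs => rw [hd' ⁅x, d i⁆]
    simp
  have h2 : ∑ i, β (d i) ⁅x, b i⁆ = ∑ i, ∑ j, B (d j) ⁅x, b i⁆ • β (d i) (b j) := by
    refine Finset.sum_congr rfl fun i _ => ?_
    conv_lhs => rw [hb ⁅x, b i⁆]
    simp
  -- Once both sums are indexed alike, the coefficients of `β (d i) (b j)` are opposite by
  -- invariance of `B`.
  rw [Finset.sum_add_distrib, h1, h2, Finset.sum_comm, ← Finset.sum_add_distrib]
  refine Finset.sum_eq_zero fun i _ => ?_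
  rw [← Finset.sum_add_distrib]
  refine Finset.sum_eq_zero fun j _ => ?_
  rw [← add_smul, hinv, neg_add_cancel, zero_smul]

variable {K : Type*} [Field K] {L : Type*} [LieRing L] [LieAlgebra K L]

/-- By invariance and nondegeneracy of the Killing form, the orthogonal of `[L, L]` is central,
hence zero. -/
theorem lie_top_top_eq_top_of_isKilling [FiniteDimensional K L] [LieAlgebra.IsKilling K L] :
    ⁅(⊤ : LieIdeal K L), (⊤ : LieIdeal K L)⁆ = ⊤ := by
  set D := ⁅(⊤ : LieIdeal K L), (⊤ : LieIdeal K L)⁆ with hD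
  have hcompl : D.killingCompl = ⊥ := by
    rw [LieSubmodule.eq_bot_iff]
    intro x hx
    rw [LieIdeal.mem_killingCompl] at hx
    have hxc : x ∈ LieAlgebra.center K L := by
      rw [LieModule.mem_maxTrivSubmodule]
      intro y
      have : killingForm K L ⁅y, x⁆ = 0 := by
        ext z
        rw [LieModule.traceForm_comm, LinearMap.zero_apply, ← LieModule.traceForm_apply_lie_apply]
        exact hx _ (LieSubmodule.lie_mem_lie (LieSubmodule.mem_top z) (LieSubmodule.mem_top y))
      have hk : ⁅y, x⁆ ∈ LinearMap.ker (killingForm K L) := this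
      rwa [LieAlgebra.IsKilling.ker_killingForm_eq_bot, Submodule.mem_bot] at hk
    rwa [LieAlgebra.center_eq_bot, LieSubmodule.mem_bot] at hxc
  simpa [hcompl] using (LieIdeal.isCompl_killingCompl D).sup_eq_top

theorem span_lie_eq_top_of_isKilling [FiniteDimensional K L] [LieAlgebra.IsKilling K L] :
    Submodule.span K {x : L | ∃ y z : L, ⁅y, z⁆ = x} = ⊤ := by
  have h := congrArg LieSubmodule.toSubmodule (lie_top_top_eq_top_of_isKilling (K := K) (L := L))
  rw [LieSubmodule.lieIdeal_oper_eq_linear_span'] at h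
  simpa using h

variable [CharZero K] [FiniteDimensional K L] [LieAlgebra.IsKilling K L]

/-- If the trace form of `V` is zero, `L = [L, L]` acts nilpotently, hence trivially, and a cocycle
vanishes on brackets. Otherwise the trace form is nondegenerate on the Killing complement `S` of its
radical; the Casimir element `C` of `S` commutes with `L` and has trace `dim S ≠ 0`, so by Schur's
argument it is invertible. -/
theorem exists_lie_eq_of_irreducible {V : Type*} [AddCommGroup V] [Module K V]
    [FiniteDimensional K V] [LieRingModule L V] [LieModule K L V] [LieModule.IsIrreducible K L V]
    (c : LieDerivation K L V) : ∃ v : V, ∀ x, c x = ⁅x, v⁆ := by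
  classical
  have hVnt : Nontrivial V := LieModule.nontrivial_of_isIrreducible K L V
  by_cases htf : LieModule.traceForm K L V = 0
  · have hnil : LieModule.IsNilpotent L V := by
      have h := LieModule.isNilpotent_derivedSeries_of_traceForm_eq_zero htf
      rw [LieModule.isNilpotent_iff_forall' (R := K)] at h ⊢
      intro x
      refine h ⟨x, ?_⟩
      rw [LieAlgebra.derivedSeries_def, LieAlgebra.derivedSeriesOfIdeal_succ,
        LieAlgebra.derivedSeriesOfIdeal_zero, lie_top_top_eq_top_of_isKilling]
      exact LieSubmodule.mem_top x
    have := LieModule.nontrivial_max_triv_of_isNilpotent K L V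
    have htop := LieSubmodule.eq_top_of_isIrreducible K L V (LieModule.maxTrivSubmodule K L V)
    have htriv : ∀ (x : L) (v : V), ⁅x, v⁆ = 0 := fun x v =>
      (LieModule.mem_maxTrivSubmodule K L V v).1 (htop ▸ LieSubmodule.mem_top v) x
    refine ⟨0, fun x => ?_⟩
    rw [lie_zero]
    have hx : x ∈ Submodule.span K {x : L | ∃ y z : L, ⁅y, z⁆ = x} := by
      rw [span_lie_eq_top_of_isKilling]; exact Submodule.mem_top
    induction hx using Submodule.span_induction with
    | mem x h =>
      obtain ⟨y, z, rfl⟩ := h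
      rw [LieDerivation.apply_lie_eq_sub, htriv, htriv, sub_zero]
    | zero => rw [map_zero]
    | add x y _ _ hx hy => rw [map_add, hx, hy, add_zero]
    | smul t x _ hx => rw [map_smul, hx, smul_zero]
  · let N : LieIdeal K L := LieAlgebra.InvariantForm.orthogonal (LieModule.traceForm K L V)
      (LieModule.traceForm_lieInvariant K L V) ⊤
    have hN : ∀ x, x ∈ N ↔ ∀ y, LieModule.traceForm K L V y x = 0 := fun x => by
      rw [LieAlgebra.InvariantForm.mem_orthogonal]
      exact ⟨fun h y => h y (LieSubmodule.mem_top y), fun h y _ => h y⟩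
    have hcompl := LieIdeal.isCompl_killingCompl N
    set S : LieIdeal K L := N.killingCompl with hS
    let B : LinearMap.BilinForm K S := (LieModule.traceForm K L V).restrict S.toSubmodule
    have hBapp : ∀ a b : S, B a b = LieModule.traceForm K L V a b := fun a b => rfl
    have hsymm : ∀ a b : S, B a b = B b a := fun a b => LieModule.traceForm_comm K L V a b
    have hBker : ∀ a : S, (∀ b : S, B b a = 0) → a = 0 := by
      intro a ha
      have haN : (a : L) ∈ N := by
        rw [hN]
        intro y
        have hy : y ∈ N ⊔ S := hcompl.sup_eq_top ▸ LieSubmodule.mem_top y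
        obtain ⟨n, hn, s, hs, rfl⟩ := (LieSubmodule.mem_sup _ _ _).1 hy
        rw [map_add, LinearMap.add_apply, LieModule.traceForm_comm K L V n, (hN n).1 hn, zero_add]
        exact ha ⟨s, hs⟩
      have : (a : L) ∈ N ⊓ S := ⟨haN, a.2⟩
      rw [hcompl.inf_eq_bot, LieSubmodule.mem_bot] at this
      exact Subtype.ext this
    have hB : B.Nondegenerate :=
      ⟨fun a ha => hBker a fun b => (hsymm b a).trans (ha b), fun a ha => hBker a ha⟩
    have hinv : B.lieInvariant L := fun x a b =>
      LieModule.traceForm_lieInvariant K L V x (a : L) (b : L)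
    let e := Module.finBasis K S
    set d := B.dualBasis hB e with hd
    let φ : L →ₗ[K] Module.End K V := (LieModule.toEnd K L V).toLinearMap
    have hφ : ∀ x v, φ x v = ⁅x, v⁆ := fun x v => rfl
    let C : Module.End K V := ∑ i, φ (d i) * φ (e i)
    have hC : ∀ v, C v = ∑ i, ⁅(d i : L), ⁅(e i : L), v⁆⁆ := fun v => by
      simp [C, hφ, LinearMap.sum_apply]
    have hCcomm : ∀ (x : L) (v : V), ⁅x, C v⁆ = C ⁅x, v⁆ := by
      intro x v
      let β : S →ₗ[K] S →ₗ[K] V := LinearMap.mk₂ K (fun a b => ⁅(a : L), ⁅(b : L), v⁆⁆)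
        (by simp) (by simp) (by simp) (by simp)
      have h := sum_lie_dualBasis_add B hB hinv e β x
      have h' : ∀ i, ⁅x, ⁅(d i : L), ⁅(e i : L), v⁆⁆⁆ = (β ⁅x, d i⁆ (e i) + β (d i) ⁅x, e i⁆) +
          ⁅(d i : L), ⁅(e i : L), ⁅x, v⁆⁆⁆ := by
        intro i
        change _ = ⁅⁅x, (d i : L)⁆, ⁅(e i : L), v⁆⁆ + ⁅(d i : L), ⁅⁅x, (e i : L)⁆, v⁆⁆ + _
        rw [leibniz_lie x (d i : L), leibniz_lie x (e i : L), lie_add]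
        abel
      rw [hC, hC, lie_sum, Finset.sum_congr rfl fun i _ => h' i, Finset.sum_add_distrib, h, zero_add]
    have htr : LinearMap.trace K V C = Module.finrank K S := by
      have h' : ∀ i, LinearMap.trace K V (φ (d i) * φ (e i)) = 1 := by
        intro i
        have := LinearMap.BilinForm.apply_dualBasis_left hB e i i
        rw [if_pos rfl] at this
        exact this
      simp only [C, map_sum, h', Finset.sum_const, Finset.card_univ, Fintype.card_fin, nsmul_eq_mul,
        mul_one]
    have hSne : Module.finrank K S ≠ 0 := by
      intro h0
      have hS0 : S = ⊥ := by
        rw [← LieSubmodule.toSubmodule_eq_bot]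
        exact Submodule.finrank_eq_zero.1 h0
      have hNtop : N = ⊤ := by simpa [hS0] using hcompl.sup_eq_top
      refine htf ?_
      ext y x
      exact (hN x).1 (hNtop ▸ LieSubmodule.mem_top x) y
    have hCne : C ≠ 0 := by
      intro h0
      rw [h0, map_zero] at htr
      exact hSne (by exact_mod_cast htr.symm)
    let kerC : LieSubmodule K L V :=
      { LinearMap.ker C with
        lie_mem := by
          intro x v hv
          have h : C v = 0 := hv
          change C ⁅x, v⁆ = 0
          rw [← hCcomm, h, lie_zero] }
    have hinj : Function.Injective C := by
      rcases IsSimpleOrder.eq_bot_or_eq_top kerC with h | h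
      · rw [← LinearMap.ker_eq_bot]
        exact (LieSubmodule.toSubmodule_eq_bot kerC).2 h
      · refine absurd ?_ hCne
        ext v
        have : v ∈ kerC := h ▸ LieSubmodule.mem_top v
        exact this
    have hsurj : Function.Surjective C := LinearMap.injective_iff_surjective.1 hinj
    -- The choice is forced: `c x = ⁅x, w⁆` implies `C w = ∑ i, d i · c (e i)`. Conversely, the
    -- cocycle identity and the invariance of `∑ i, d i ⊗ e i` yield `x · C w = C (c x)`.
    obtain ⟨w, hw⟩ := hsurj (∑ i, ⁅(d i : L), c (e i : L)⁆)
    refine ⟨w, fun x => hinj ?_⟩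
    rw [← hCcomm, hw]
    let β : S →ₗ[K] S →ₗ[K] V := LinearMap.mk₂ K (fun a b => ⁅(a : L), c (b : L)⁆)
        (by simp) (by simp) (by simp) (by simp)
    have h := sum_lie_dualBasis_add B hB hinv e β x
    have h' : ∀ i, ⁅x, ⁅(d i : L), c (e i : L)⁆⁆ = (β ⁅x, d i⁆ (e i) + β (d i) ⁅x, e i⁆) +
        ⁅(d i : L), ⁅(e i : L), c x⁆⁆ := by
      intro i
      change _ = ⁅⁅x, (d i : L)⁆, c (e i : L)⁆ + ⁅(d i : L), c ⁅x, (e i : L)⁆⁆ + _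
      rw [leibniz_lie x (d i : L), LieDerivation.apply_lie_eq_sub, lie_sub]
      abel
    rw [lie_sum, Finset.sum_congr rfl fun i _ => h' i, Finset.sum_add_distrib, h, zero_add, hC]

/-- Whitehead's first lemma. -/
theorem exists_lie_eq_of_isKilling {V : Type*} [AddCommGroup V] [Module K V]
    [FiniteDimensional K V] [LieRingModule L V] [LieModule K L V]
    (c : LieDerivation K L V) : ∃ v : V, ∀ x, c x = ⁅x, v⁆ := by
  obtain ⟨n, hn⟩ : ∃ n, Module.finrank K V = n := ⟨_, rfl⟩
  induction n using Nat.strong_induction_on generalizing V with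
  | _ n ih =>
  by_cases hirr : LieModule.IsIrreducible K L V
  · exact exists_lie_eq_of_irreducible c
  rcases subsingleton_or_nontrivial V with hV | hV
  · exact ⟨0, fun x => Subsingleton.elim _ _⟩
  -- Solving modulo a proper nonzero submodule `W` and lifting the solution leaves a cocycle with
  -- values in `W`.
  obtain ⟨W, hW0, hW1⟩ : ∃ W : LieSubmodule K L V, W ≠ ⊥ ∧ W ≠ ⊤ := by
    by_contra! h
    exact hirr (LieModule.IsIrreducible.mk fun N hN => h N hN)
  have hW1' : W.toSubmodule ≠ ⊤ := fun h => hW1 ((LieSubmodule.toSubmodule_eq_top W).1 h)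
  have hW0' : W.toSubmodule ≠ ⊥ := fun h => hW0 ((LieSubmodule.toSubmodule_eq_bot W).1 h)
  have hlt : Module.finrank K W < n := hn ▸ Submodule.finrank_lt hW1'
  have hlt' : Module.finrank K (V ⧸ W) < n := by
    have h1 := Submodule.finrank_quotient_add_finrank W.toSubmodule
    have h2 : 0 < Module.finrank K W.toSubmodule := by
      rw [Nat.pos_iff_ne_zero]
      exact fun h => hW0' (Submodule.finrank_eq_zero.1 h)
    have h3 : Module.finrank K (V ⧸ W.toSubmodule) = Module.finrank K (V ⧸ W) := rfl
    omega
  let π := LieSubmodule.Quotient.mk' W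
  have hfd : FiniteDimensional K (V ⧸ W) :=
    inferInstanceAs (FiniteDimensional K (V ⧸ W.toSubmodule))
  let c₁ : LieDerivation K L (V ⧸ W) :=
    { toLinearMap := π.toLinearMap ∘ₗ c.toLinearMap
      leibniz' := fun a b => by
        change π (c ⁅a, b⁆) = ⁅a, π (c b)⁆ - ⁅b, π (c a)⁆
        rw [LieDerivation.apply_lie_eq_sub, map_sub, LieModuleHom.map_lie, LieModuleHom.map_lie] }
  obtain ⟨q, hq⟩ := ih _ hlt' c₁ rfl
  obtain ⟨v, rfl⟩ : ∃ v, π v = q := LieSubmodule.Quotient.surjective_mk' W q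
  have hmem : ∀ x, c x - ⁅x, v⁆ ∈ W := by
    intro x
    have h : π (c x) = ⁅x, π v⁆ := hq x
    rw [← LieModuleHom.map_lie, ← sub_eq_zero, ← map_sub] at h
    exact (LieSubmodule.Quotient.mk_eq_zero W).1 h
  let c₂ : LieDerivation K L W :=
    { toFun := fun x => ⟨c x - ⁅x, v⁆, hmem x⟩
      map_add' := fun x y => by ext; simp; abel
      map_smul' := fun t x => by ext; simp [smul_sub]
      leibniz' := fun a b => by
        apply Subtype.ext
        change c ⁅a, b⁆ - ⁅⁅a, b⁆, v⁆ = ⁅a, c b - ⁅b, v⁆⁆ - ⁅b, c a - ⁅a, v⁆⁆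
        rw [LieDerivation.apply_lie_eq_sub, lie_lie, lie_sub, lie_sub]
        abel }
  obtain ⟨w, hw⟩ := ih _ hlt c₂ rfl
  refine ⟨v + w, fun x => ?_⟩
  have h : c x - ⁅x, v⁆ = ⁅x, (w : V)⁆ := congrArg Subtype.val (hw x)
  rw [lie_add, ← h]
  abel

end Whitehead

end GammaDecomp

namespace GammaDecomp

/-! ### Cohomology of commuting endomorphisms, and higher derivations. -/

section Auxiliary

/-- First cohomology of a commuting family of endomorphisms `T i` with `ker T i = ker (T i)²` and
without common kernel: every cocycle is a coboundary. -/
theorem exists_forall_eq_apply_of_commuting {K V ι : Type*} [Field K] [AddCommGroup V] [Module K V]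
    [FiniteDimensional K V] (T : ι → Module.End K V) (hker : ∀ i v, T i (T i v) = 0 → T i v = 0)
    (hcomm : ∀ i j v, T i (T j v) = T j (T i v)) (W : Submodule K V)
    (hW : ∀ i, ∀ w ∈ W, T i w ∈ W) (hW0 : ∀ w ∈ W, (∀ i, T i w = 0) → w = 0) (c : ι → V)
    (hc : ∀ i, c i ∈ W) (hcc : ∀ i j, T i (c j) = T j (c i)) : ∃ v ∈ W, ∀ i, c i = T i v := by
  obtain ⟨n, hn⟩ : ∃ n, Module.finrank K W = n := ⟨_, rfl⟩
  induction n using Nat.strong_induction_on generalizing W c with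
  | _ n ih =>
  by_cases hz : ∀ i, ∀ w ∈ W, T i w = 0
  · refine ⟨0, zero_mem _, fun i => ?_⟩
    rw [map_zero]
    exact hW0 _ (hc i) fun j => hz j _ (hc i)
  push Not at hz
  obtain ⟨t, w, hw, hwt⟩ := hz
  -- As `ker T t = ker (T t)²`, the space `W` is the sum of the kernel and the image of `T t`. A
  -- coboundary therefore moves `c t` into the kernel, and the cocycle identity then moves every `c
  -- i` into the smaller space `W₀`.
  set W₀ := W ⊓ LinearMap.ker (T t) with hW₀
  have hlt : W₀ < W := by
    refine lt_of_le_of_ne inf_le_left fun h => hwt ?_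
    have : w ∈ W₀ := h ▸ hw
    exact this.2
  have hfin : Module.finrank K W₀ < n := hn ▸ Submodule.finrank_lt_finrank_of_lt hlt
  obtain ⟨v₀, hv₀, hv₀'⟩ : ∃ v₀ ∈ W, T t (c t - T t v₀) = 0 := by
    let f : Module.End K W := (T t).restrict (hW t)
    have hf : ∀ x : W, (f x : V) = T t x := fun x => rfl
    have hdisj : Disjoint (LinearMap.ker f) (LinearMap.range f) := by
      rw [Submodule.disjoint_def]
      rintro _ hx ⟨y, rfl⟩
      have h1 : f (f y) = 0 := hx
      have h2 : T t (T t y) = 0 := congrArg Subtype.val h1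
      exact Subtype.ext (hker t y h2)
    have htop : LinearMap.ker f ⊔ LinearMap.range f = ⊤ := by
      refine Submodule.eq_top_of_disjoint _ _ ?_ hdisj
      rw [add_comm, LinearMap.finrank_range_add_finrank_ker]
    have hct : (⟨c t, hc t⟩ : W) ∈ LinearMap.ker f ⊔ LinearMap.range f :=
      htop ▸ Submodule.mem_top
    obtain ⟨a, ha, _, ⟨v₀, rfl⟩, hav⟩ := Submodule.mem_sup.1 hct
    refine ⟨v₀, v₀.2, ?_⟩
    have h1 : (a : V) + T t v₀ = c t := congrArg Subtype.val hav
    have h2 : T t a = 0 := congrArg Subtype.val (show f a = 0 from ha)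
    rw [← h1, add_sub_cancel_right, h2]
  have hc' : ∀ i, c i - T i v₀ ∈ W₀ := by
    intro i
    refine ⟨sub_mem (hc i) (hW i _ hv₀), hker t _ ?_⟩
    rw [map_sub, hcc, hcomm t i, ← map_sub, hcomm t i, hv₀', map_zero]
  obtain ⟨v₁, hv₁, h⟩ := ih _ hfin W₀
    (fun i w hw => ⟨hW i w hw.1, by
      change T t (T i w) = 0
      rw [hcomm, show T t w = 0 from hw.2, map_zero]⟩)
    (fun w hw h => hW0 w hw.1 h) (fun i => c i - T i v₀) hc'
    (fun i j => by rw [map_sub, map_sub, hcc i j, hcomm i j]) rfl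
  refine ⟨v₀ + v₁, add_mem hv₀ hv₁.1, fun i => ?_⟩
  rw [map_add, ← h i, add_sub_cancel]

variable {K : Type*} [Field K] {L s : Type*} [LieRing L] [LieAlgebra K L] [LieRing s]
  [LieAlgebra K s]

theorem map_derivedSeriesOfIdeal_mem (f : L →ₗ⁅K⁆ s) (I : LieIdeal K L) (J : LieIdeal K s)
    (h : ∀ u ∈ I, f u ∈ J) (n : ℕ) {u : L} (hu : u ∈ LieAlgebra.derivedSeriesOfIdeal K L n I) :
    f u ∈ LieAlgebra.derivedSeriesOfIdeal K s n J := by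
  induction n generalizing u with
  | zero => exact h u hu
  | succ n ih =>
    rw [LieAlgebra.derivedSeriesOfIdeal_succ] at hu ⊢
    replace hu : u ∈ (⁅LieAlgebra.derivedSeriesOfIdeal K L n I,
      LieAlgebra.derivedSeriesOfIdeal K L n I⁆ : LieIdeal K L).toSubmodule := hu
    rw [LieSubmodule.lieIdeal_oper_eq_linear_span'] at hu
    induction hu using Submodule.span_induction with
    | mem x hx =>
      obtain ⟨y, hy, z, hz, rfl⟩ := hx
      rw [LieHom.map_lie]
      exact LieSubmodule.lie_mem_lie (ih hy) (ih hz)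
    | zero => rw [map_zero]; exact zero_mem _
    | add x y hx hy ihx ihy => rw [map_add]; exact add_mem ihx ihy
    | smul t x hx ihx => rw [map_smul]; exact SMulMemClass.smul_mem t ihx

variable [CharZero K]

/-- Let `E n : L → s` be a higher derivation whose zeroth term vanishes on the ideal `R`.  An ideal
`J` of `s` contained in `E 1 R` has its `n`-th derived ideal contained in the image under
`E (2 ^ n)` of the `n`-th derived ideal of `R`. -/
theorem derivedSeries_subset_image_higherDerivation (E : ℕ → L →ₗ[K] s)
    (hE : ∀ n a b, E n ⁅a, b⁆ = ∑ i ∈ Finset.range (n + 1), n.choose i • ⁅E i a, E (n - i) b⁆)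
    (R : LieIdeal K L) (hR : ∀ u ∈ R, E 0 u = 0) (J : LieIdeal K s)
    (hJ : ∀ j ∈ J, ∃ u ∈ R, E 1 u = j) (n : ℕ) :
    (∀ a < 2 ^ n, ∀ u ∈ LieAlgebra.derivedSeriesOfIdeal K L n R, E a u = 0) ∧
      ∀ j ∈ LieAlgebra.derivedSeriesOfIdeal K s n J,
        ∃ u ∈ LieAlgebra.derivedSeriesOfIdeal K L n R, E (2 ^ n) u = j := by
  induction n with
  | zero =>
    simp only [LieAlgebra.derivedSeriesOfIdeal_zero, pow_zero]
    exact ⟨fun a ha u hu => by rw [Nat.lt_one_iff.1 ha]; exact hR u hu, hJ⟩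
  | succ n ih =>
    obtain ⟨ih1, ih2⟩ := ih
    rw [LieAlgebra.derivedSeriesOfIdeal_succ, LieAlgebra.derivedSeriesOfIdeal_succ]
    set D := LieAlgebra.derivedSeriesOfIdeal K L n R
    set D' := LieAlgebra.derivedSeriesOfIdeal K s n J
    have h2 : 2 ^ (n + 1) = 2 ^ n + 2 ^ n := by ring
    have hpos : 0 < 2 ^ n := by positivity
    constructor
    · intro a ha u hu
      have hu' : u ∈ (⁅D, D⁆ : LieIdeal K L).toSubmodule := hu
      rw [LieSubmodule.lieIdeal_oper_eq_linear_span'] at hu'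
      have hle : Submodule.span K {x | ∃ y ∈ D, ∃ z ∈ D, ⁅y, z⁆ = x} ≤ LinearMap.ker (E a) := by
        rw [Submodule.span_le]
        rintro _ ⟨y, hy, z, hz, rfl⟩
        change E a ⁅y, z⁆ = 0
        rw [hE]
        refine Finset.sum_eq_zero fun i hi => ?_
        rw [Finset.mem_range] at hi
        rcases lt_or_ge i (2 ^ n) with h | h
        · rw [ih1 i h y hy, zero_lie, smul_zero]
        · rw [ih1 (a - i) (by omega) z hz, lie_zero, smul_zero]
      exact hle hu'
    · intro j hj
      have hj' : j ∈ (⁅D', D'⁆ : LieIdeal K s).toSubmodule := hj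
      rw [LieSubmodule.lieIdeal_oper_eq_linear_span'] at hj'
      have hle : Submodule.span K {x | ∃ y ∈ D', ∃ z ∈ D', ⁅y, z⁆ = x} ≤
          (⁅D, D⁆ : LieIdeal K L).toSubmodule.map (E (2 ^ (n + 1))) := by
        rw [Submodule.span_le]
        rintro _ ⟨y, hy, z, hz, rfl⟩
        obtain ⟨u, hu, rfl⟩ := ih2 y hy
        obtain ⟨w, hw, rfl⟩ := ih2 z hz
        -- In Leibniz's formula only the middle term survives, since in every other term one of the
        -- two orders is below `2 ^ n`. Its binomial coefficient is invertible in characteristic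
        -- zero.
        have hmid : E (2 ^ (n + 1)) ⁅u, w⁆ =
            (2 ^ (n + 1)).choose (2 ^ n) • ⁅E (2 ^ n) u, E (2 ^ n) w⁆ := by
          rw [hE, Finset.sum_eq_single (2 ^ n)]
          · rw [h2, Nat.add_sub_cancel]
          · intro i hi hne
            rw [Finset.mem_range] at hi
            rcases lt_or_ge i (2 ^ n) with h | h
            · rw [ih1 i h u hu, zero_lie, smul_zero]
            · rw [ih1 (2 ^ (n + 1) - i) (by omega) w hw, lie_zero, smul_zero]
          · intro h
            exact absurd (Finset.mem_range.2 (by omega)) h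
        have hch : ((2 ^ (n + 1)).choose (2 ^ n) : K) ≠ 0 := by
          rw [Nat.cast_ne_zero]
          exact (Nat.choose_pos (by omega)).ne'
        refine ⟨((2 ^ (n + 1)).choose (2 ^ n) : K)⁻¹ • ⁅u, w⁆, ?_, ?_⟩
        · exact Submodule.smul_mem _ _ (LieSubmodule.lie_mem_lie hu hw)
        · rw [map_smul, hmid, ← Nat.cast_smul_eq_nsmul K, smul_smul, inv_mul_cancel₀ hch, one_smul]
      obtain ⟨u, hu, hu'⟩ := hle hj'
      exact ⟨u, hu, hu'⟩

/-- A Lie algebra with trivial radical has no nonzero ideal contained in the image of a solvable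
ideal under the first term of a higher derivation. -/
theorem eq_bot_of_forall_exists_higherDerivation_eq [LieAlgebra.HasTrivialRadical K s]
    (E : ℕ → L →ₗ[K] s)
    (hE : ∀ n a b, E n ⁅a, b⁆ = ∑ i ∈ Finset.range (n + 1), n.choose i • ⁅E i a, E (n - i) b⁆)
    (R : LieIdeal K L) [hsolv : LieAlgebra.IsSolvable R] (hR : ∀ u ∈ R, E 0 u = 0)
    (J : LieIdeal K s) (hJ : ∀ j ∈ J, ∃ u ∈ R, E 1 u = j) : J = ⊥ := by
  obtain ⟨n, hn⟩ := (LieAlgebra.isSolvable_iff K R).1 hsolv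
  rw [LieIdeal.derivedSeries_eq_bot_iff] at hn
  have h := (derivedSeries_subset_image_higherDerivation E hE R hR J hJ n).2
  have hJn : LieAlgebra.derivedSeriesOfIdeal K s n J = ⊥ := by
    rw [LieSubmodule.eq_bot_iff]
    intro j hj
    obtain ⟨u, hu, rfl⟩ := h j hj
    rw [hn, LieSubmodule.mem_bot] at hu
    rw [hu, map_zero]
  have : LieAlgebra.IsSolvable J :=
    LieAlgebra.IsSolvable.mk ((LieIdeal.derivedSeries_eq_bot_iff J n).2 hJn)
  exact LieAlgebra.HasTrivialRadical.eq_bot_of_isSolvable J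

end Auxiliary

end GammaDecomp

namespace GammaDecomp
-- The natural module of a completely reducible subalgebra of `gl(V)`.
section NaturalModule

variable {K : Type u} [Field K] {V : Type v} [AddCommGroup V] [Module K V]
  {Γ : LieSubalgebra K (Module.End K V)}

theorem IsCompletelyReducible.complementedLattice (h : IsCompletelyReducible Γ) :
    ComplementedLattice (LieSubmodule K Γ V) := by
  refine ⟨fun W => ?_⟩
  obtain ⟨W', hW', hc⟩ := h W.toSubmodule fun γ hγ w hw =>
    W.lie_mem (x := (⟨γ, hγ⟩ : Γ)) hw
  refine ⟨{ W' with lie_mem := fun {γ w} hw => hW' γ γ.2 w hw }, ?_⟩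
  rw [← LieSubmodule.isCompl_toSubmodule]
  exact hc

theorem isFaithful_of_lieSubalgebra : LieModule.IsFaithful K Γ V := by
  refine ⟨?_⟩
  intro γ γ' h
  apply Subtype.ext
  ext x
  exact LinearMap.congr_fun h x

end NaturalModule

namespace GammaTriple

/-! ### The Levi factor as the quotient of `L` by its radical. -/

section LeviProjection

variable {K : Type u} [Field K] {L : Type v} [LieRing L] [LieAlgebra K L] [FiniteDimensional K L]
  {Γ : LieSubalgebra K (Module.End K L)} (T : GammaTriple Γ)

/-- The projection of `L` onto the Levi subalgebra `s` along the radical. -/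
noncomputable def sProjLin : L →ₗ[K] T.s :=
  T.s.toSubmodule.projectionOnto (LieAlgebra.radical K L).toSubmodule T.levi

theorem sProjLin_of_mem_s {x : L} (hx : x ∈ T.s) : T.sProjLin x = ⟨x, hx⟩ :=
  Submodule.projectionOnto_apply_of_mem_left T.levi hx

theorem sProjLin_eq_zero_iff {x : L} : T.sProjLin x = 0 ↔ x ∈ LieAlgebra.radical K L :=
  Submodule.projectionOnto_apply_eq_zero_iff T.levi

theorem sub_sProjLin_mem (x : L) : x - (T.sProjLin x : L) ∈ LieAlgebra.radical K L := by
  rw [← T.sProjLin_eq_zero_iff, map_sub, T.sProjLin_of_mem_s (T.sProjLin x).2, sub_self]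

/-- The projection of `L` onto the Levi subalgebra `s` along the radical. -/
noncomputable def sProj : L →ₗ⁅K⁆ T.s :=
  { T.sProjLin with
    map_lie' := by
      intro x y
      change T.sProjLin ⁅x, y⁆ = ⁅T.sProjLin x, T.sProjLin y⁆
      have h1 : ⁅x, y⁆ - ⁅(T.sProjLin x : L), (T.sProjLin y : L)⁆ ∈ LieAlgebra.radical K L := by
        have e : ⁅x, y⁆ - ⁅(T.sProjLin x : L), (T.sProjLin y : L)⁆ =
            ⁅x - T.sProjLin x, y⁆ + ⁅(T.sProjLin x : L), y - T.sProjLin y⁆ := by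
          rw [sub_lie, lie_sub]; abel
        rw [e]
        exact add_mem (lie_mem_left K L _ _ _ (T.sub_sProjLin_mem x))
          (lie_mem_right K L _ _ _ (T.sub_sProjLin_mem y))
      rw [← T.sProjLin_eq_zero_iff, map_sub, sub_eq_zero] at h1
      rw [h1]
      exact T.sProjLin_of_mem_s (T.s.lie_mem (T.sProjLin x).2 (T.sProjLin y).2) }

theorem sProj_coe (x : T.s) : T.sProj (x : L) = x := T.sProjLin_of_mem_s x.2

theorem sProj_eq_zero_iff {x : L} : T.sProj x = 0 ↔ x ∈ LieAlgebra.radical K L :=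
  T.sProjLin_eq_zero_iff

theorem sub_sProj_mem (x : L) : x - (T.sProj x : L) ∈ LieAlgebra.radical K L :=
  T.sub_sProjLin_mem x

/-- The preimage in `L` of a solvable ideal of `s` is an extension by the solvable radical; it is
solvable, so it lies in the radical, whose image in `s` is zero. -/
instance hasTrivialRadical_s : LieAlgebra.HasTrivialRadical K T.s := by
  refine LieAlgebra.hasTrivialRadical_of_no_solvable_ideals fun J hJ => ?_
  obtain ⟨n, hn⟩ := (LieAlgebra.isSolvable_iff K J).1 hJ
  rw [LieIdeal.derivedSeries_eq_bot_iff] at hn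
  obtain ⟨k, hk⟩ := (LieAlgebra.isSolvable_iff K (LieAlgebra.radical K L)).1 inferInstance
  rw [LieIdeal.derivedSeries_eq_bot_iff] at hk
  set I : LieIdeal K L := J.comap T.sProj with hI
  have hmem : ∀ u, u ∈ I ↔ T.sProj u ∈ J := fun u => LieIdeal.mem_comap
  have hle : LieAlgebra.derivedSeriesOfIdeal K L n I ≤ LieAlgebra.radical K L := by
    intro u hu
    have := map_derivedSeriesOfIdeal_mem T.sProj I J (fun u hu => (hmem u).1 hu) n hu
    rw [hn, LieSubmodule.mem_bot] at this
    exact T.sProj_eq_zero_iff.1 this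
  have hIsolv : LieAlgebra.IsSolvable I := by
    refine LieAlgebra.IsSolvable.mk (R := K) (k := k + n) ?_
    rw [LieIdeal.derivedSeries_eq_bot_iff, LieAlgebra.derivedSeriesOfIdeal_add, eq_bot_iff, ← hk]
    exact LieAlgebra.derivedSeriesOfIdeal_mono hle k
  have hIrad : I ≤ LieAlgebra.radical K L := (LieAlgebra.LieIdeal.solvable_iff_le_radical K L I).1 hIsolv
  rw [LieSubmodule.eq_bot_iff]
  intro j hj
  have h1 : (j : L) ∈ I := by rw [hmem, T.sProj_coe]; exact hj
  rw [← T.sProj_coe j]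
  exact T.sProj_eq_zero_iff.2 (hIrad h1)

end LeviProjection

/-! ### The decomposition `Γ = ad s + gammaRad` and its action on `m`. -/

section GammaStructure

variable {K : Type u} [Field K] {L : Type v} [LieRing L] [LieAlgebra K L] [FiniteDimensional K L]
  {Γ : LieSubalgebra K (Module.End K L)} (T : GammaTriple Γ)

theorem map_radical {γ : Module.End K L} (hγ : γ ∈ Γ) {x : L}
    (hx : x ∈ LieAlgebra.radical K L) : γ x ∈ T.m := by
  rw [T.m_eq]
  exact Submodule.subset_span ⟨γ, hγ, x, hx, rfl⟩

theorem lie_ad (T : GammaTriple Γ) {γ : Module.End K L} (hγ : γ ∈ Γ) (u : L) :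
    ⁅γ, LieAlgebra.ad K L u⁆ = LieAlgebra.ad K L (γ u) := by
  ext x
  have := T.map_lie hγ u x
  simp [Ring.lie_def, this]

/-- The ideal of the elements of `Γ` that map `L` into the radical. -/
def gammaRad : LieIdeal K Γ where
  carrier := {γ | ∀ x, (γ : Module.End K L) x ∈ LieAlgebra.radical K L}
  add_mem' ha hb x := add_mem (ha x) (hb x)
  zero_mem' x := zero_mem _
  smul_mem' c γ hγ x := SMulMemClass.smul_mem c (hγ x)
  lie_mem := by
    intro γ γ' h x
    change (γ : Module.End K L) ((γ' : Module.End K L) x) -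
      (γ' : Module.End K L) ((γ : Module.End K L) x) ∈ LieAlgebra.radical K L
    exact sub_mem (T.m_le_radical (T.map_radical γ.2 (h x))) (h _)

/-- The ideal of the inner derivations in `Γ` that come from elements of the radical. -/
def gammaInner : LieIdeal K Γ where
  carrier := {γ | ∃ u ∈ LieAlgebra.radical K L, (γ : Module.End K L) = LieAlgebra.ad K L u}
  add_mem' := by
    rintro a b ⟨u, hu, ha⟩ ⟨w, hw, hb⟩
    exact ⟨u + w, add_mem hu hw, by rw [map_add, ← ha, ← hb]; rfl⟩
  zero_mem' := ⟨0, zero_mem _, by rw [map_zero]; rfl⟩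
  smul_mem' := by
    rintro c a ⟨u, hu, ha⟩
    exact ⟨c • u, SMulMemClass.smul_mem c hu, by rw [map_smul, ← ha]; rfl⟩
  lie_mem := by
    rintro γ a ⟨u, hu, ha⟩
    refine ⟨(γ : Module.End K L) u, T.m_le_radical (T.map_radical γ.2 hu), ?_⟩
    rw [← T.lie_ad γ.2, ← ha]
    rfl

instance isSolvable_gammaInner : LieAlgebra.IsSolvable T.gammaInner := by
  obtain ⟨k, hk⟩ := (LieAlgebra.isSolvable_iff K (LieAlgebra.radical K L)).1 inferInstance
  rw [LieIdeal.derivedSeries_eq_bot_iff] at hk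
  have key : ∀ n, ∀ γ ∈ LieAlgebra.derivedSeriesOfIdeal K Γ n T.gammaInner,
      ∃ u ∈ LieAlgebra.derivedSeriesOfIdeal K L n (LieAlgebra.radical K L),
        (γ : Module.End K L) = LieAlgebra.ad K L u := by
    intro n
    induction n with
    | zero => exact fun γ hγ => hγ
    | succ n ih =>
      intro γ hγ
      rw [LieAlgebra.derivedSeriesOfIdeal_succ] at hγ ⊢
      replace hγ : γ ∈ (⁅LieAlgebra.derivedSeriesOfIdeal K Γ n T.gammaInner,
        LieAlgebra.derivedSeriesOfIdeal K Γ n T.gammaInner⁆ : LieIdeal K Γ).toSubmodule := hγ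
      rw [LieSubmodule.lieIdeal_oper_eq_linear_span'] at hγ
      induction hγ using Submodule.span_induction with
      | mem x hx =>
        obtain ⟨y, hy, z, hz, rfl⟩ := hx
        obtain ⟨u, hu, hu'⟩ := ih y hy
        obtain ⟨w, hw, hw'⟩ := ih z hz
        refine ⟨⁅u, w⁆, LieSubmodule.lie_mem_lie hu hw, ?_⟩
        rw [LieHom.map_lie, ← hu', ← hw']
        rfl
      | zero => exact ⟨0, zero_mem _, by rw [map_zero]; rfl⟩
      | add x y _ _ hx hy =>
        obtain ⟨u, hu, hu'⟩ := hx
        obtain ⟨w, hw, hw'⟩ := hy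
        exact ⟨u + w, add_mem hu hw, by rw [map_add, ← hu', ← hw']; rfl⟩
      | smul t x _ hx =>
        obtain ⟨u, hu, hu'⟩ := hx
        exact ⟨t • u, SMulMemClass.smul_mem t hu, by rw [map_smul, ← hu']; rfl⟩
  refine LieAlgebra.IsSolvable.mk (R := K) (k := k) ?_
  rw [LieIdeal.derivedSeries_eq_bot_iff, LieSubmodule.eq_bot_iff]
  intro γ hγ
  obtain ⟨u, hu, hγu⟩ := key k γ hγ
  rw [hk, LieSubmodule.mem_bot] at hu
  apply Subtype.ext
  rw [hγu, hu, map_zero]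
  rfl

/-- A commutator in `Γ` is some `ad u`. If it maps `L` into the radical, the image of `u` in `s` is
central, hence zero, and `u` lies in the radical. -/
theorem lie_gammaRad_le : ⁅T.gammaRad, T.gammaRad⁆ ≤ T.gammaInner := by
  rw [LieSubmodule.lieIdeal_oper_eq_span, LieSubmodule.lieSpan_le]
  rintro _ ⟨⟨γ, hγ⟩, ⟨γ', hγ'⟩, rfl⟩
  obtain ⟨u, hu⟩ := lie_algebraicHull_ad_mem (T.mcr.prop.1 γ.2) (T.mcr.prop.1 γ'.2)
  have happ : ∀ x, ⁅u, x⁆ = (γ : Module.End K L) ((γ' : Module.End K L) x) -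
      (γ' : Module.End K L) ((γ : Module.End K L) x) := fun x => LinearMap.congr_fun hu x
  have hrad : ∀ x, ⁅u, x⁆ ∈ LieAlgebra.radical K L := fun x => by
    rw [happ]
    exact sub_mem (hγ _) (hγ' _)
  refine ⟨u, ?_, hu.symm⟩
  rw [← T.sProj_eq_zero_iff, ← LieSubmodule.mem_bot (R := K) (L := T.s),
    ← LieAlgebra.center_eq_bot K T.s, LieModule.mem_maxTrivSubmodule]
  intro x
  rw [← T.sProj_coe x, ← LieHom.map_lie, T.sProj_eq_zero_iff, ← lie_skew]
  exact neg_mem (hrad _)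

/-- The elements of `𝔅` induced by the central part of `Γ`. -/
def torus : Set T.frakB :=
  {y | ∃ γ ∈ T.gammaRad, ∀ z : T.m, ((y : Module.End K T.m) z : L) = (γ : Module.End K L) z}

theorem frakB_comm (y : T.frakB) {γ : Module.End K L} (hγ : γ ∈ Γ) (z : T.m) :
    ((y : Module.End K T.m) ⟨γ z, T.map_m hγ z.2⟩ : L) = γ ((y : Module.End K T.m) z : L) := by
  obtain ⟨y, D, hD, hy⟩ := y
  have h := congrArg Subtype.val (hD γ hγ ⟨z, T.m_le_nHat z.2⟩)
  change (y ⟨γ z, T.map_m hγ z.2⟩ : L) = γ (y z : L)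
  rw [← hy, ← hy]
  exact h

/-- Elements of `𝔅` commute with `Γ` on `m`, and `torus` consists of restrictions of elements of
`Γ`. -/
theorem lie_torus (y' : T.frakB) {y : T.frakB} (hy : y ∈ T.torus) : ⁅y', y⁆ = 0 := by
  obtain ⟨γ, -, hy⟩ := hy
  apply Subtype.ext
  ext z
  change (((y' : Module.End K T.m) ((y : Module.End K T.m) z) -
    (y : Module.End K T.m) ((y' : Module.End K T.m) z) : T.m) : L) = 0
  have h1 : (y : Module.End K T.m) z = ⟨(γ : Module.End K L) z, T.map_m γ.2 z.2⟩ :=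
    Subtype.ext (hy z)
  rw [AddSubgroupClass.coe_sub, hy, h1, T.frakB_comm y' γ.2, sub_self]

variable [CharZero K]

/-- The derived ideal of `gammaRad` lies in the solvable ideal `gammaInner`, so `gammaRad` is
solvable, and solvable ideals of `Γ` are central by complete reducibility of `L`. -/
theorem gammaRad_le_center : T.gammaRad ≤ LieAlgebra.center K Γ := by
  obtain ⟨k, hk⟩ := (LieAlgebra.isSolvable_iff K T.gammaInner).1 inferInstance
  rw [LieIdeal.derivedSeries_eq_bot_iff] at hk
  have hsolv : LieAlgebra.IsSolvable T.gammaRad := by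
    refine LieAlgebra.IsSolvable.mk (R := K) (k := k + 1) ?_
    rw [LieIdeal.derivedSeries_eq_bot_iff, LieAlgebra.derivedSeriesOfIdeal_add, eq_bot_iff, ← hk]
    exact LieAlgebra.derivedSeriesOfIdeal_mono T.lie_gammaRad_le k
  have := T.mcr.prop.2.complementedLattice
  have := isFaithful_of_lieSubalgebra (Γ := Γ)
  exact le_center_of_isSolvable L T.gammaRad

theorem gammaRad_comm {γ : Γ} (hγ : γ ∈ T.gammaRad) {γ' : Module.End K L} (hγ' : γ' ∈ Γ) (x : L) :
    (γ : Module.End K L) (γ' x) = γ' ((γ : Module.End K L) x) := by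
  have h := (LieModule.mem_maxTrivSubmodule K Γ Γ γ).1 (T.gammaRad_le_center hγ) ⟨γ', hγ'⟩
  have h' : γ' ((γ : Module.End K L) x) - (γ : Module.End K L) (γ' x) = 0 :=
    LinearMap.congr_fun (congrArg Subtype.val h) x
  exact (sub_eq_zero.1 h').symm

/-- The derivation that `γ` induces on `s ≅ L / rad L` is inner, equal to some `ad x`; then `γ - ad
x` maps `L` into the radical. -/
theorem exists_sub_ad_mem_gammaRad (γ : Γ) :
    ∃ (x : T.s) (γ₀ : Γ), γ₀ ∈ T.gammaRad ∧
      ∀ y, (γ : Module.End K L) y = ⁅(x : L), y⁆ + (γ₀ : Module.End K L) y := by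
  let δ : LieDerivation K T.s T.s :=
    { toLinearMap := T.sProj.toLinearMap ∘ₗ (γ : Module.End K L) ∘ₗ T.s.toSubmodule.subtype
      leibniz' := by
        intro a b
        change T.sProj ((γ : Module.End K L) ⁅(a : L), (b : L)⁆) =
          ⁅a, T.sProj ((γ : Module.End K L) (b : L))⁆ - ⁅b, T.sProj ((γ : Module.End K L) (a : L))⁆
        rw [T.map_lie γ.2, map_add, LieHom.map_lie, LieHom.map_lie, T.sProj_coe, T.sProj_coe,
          ← lie_skew b, sub_neg_eq_add, add_comm] }
  obtain ⟨x, hx⟩ := LieDerivation.IsKilling.exists_eq_ad δ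
  have hδ : ∀ a : T.s, T.sProj ((γ : Module.End K L) (a : L)) = ⁅x, a⁆ := fun a => by
    have h := LieDerivation.congr_fun hx a
    rw [LieDerivation.ad_apply_apply] at h
    exact h.symm
  let γ₁ : Γ := ⟨LieAlgebra.ad K L (x : L), T.ad_s_mem x x.2⟩
  refine ⟨x, γ - γ₁, ?_, fun y => ?_⟩
  · intro y
    change (γ : Module.End K L) y - ⁅(x : L), y⁆ ∈ LieAlgebra.radical K L
    have hy := T.sub_sProj_mem y
    have e : (γ : Module.End K L) y - ⁅(x : L), y⁆ =
        ((γ : Module.End K L) (T.sProj y : L) - ⁅(x : L), (T.sProj y : L)⁆) +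
        ((γ : Module.End K L) (y - T.sProj y) - ⁅(x : L), y - (T.sProj y : L)⁆) := by
      rw [map_sub, lie_sub]; abel
    rw [e]
    refine add_mem ?_ (sub_mem (T.m_le_radical (T.map_radical γ.2 hy)) (lie_mem_right K L _ _ _ hy))
    rw [← T.sProj_eq_zero_iff, map_sub, hδ, LieHom.map_lie, T.sProj_coe, T.sProj_coe, sub_self]
  · change _ = _ + ((γ : Module.End K L) y - ⁅(x : L), y⁆)
    abel

/-- Elements of `gammaRad` are derivations stabilizing `n̂` and, being central, commute with `Γ`;
their restrictions to `m` thus belong to `𝔅`. -/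
theorem exists_mem_torus {γ : Γ} (hγ : γ ∈ T.gammaRad) :
    ∃ y ∈ T.torus, ∀ z : T.m, ((y : Module.End K T.m) z : L) = (γ : Module.End K L) z := by
  have hmem : (γ : Module.End K L).restrict (p := T.m) (q := T.m) (fun z hz => T.map_m γ.2 hz) ∈
      T.frakB := by
    refine ⟨{ toLinearMap := (γ : Module.End K L).restrict fun n hn => T.map_nHat γ.2 hn
              leibniz' := ?_ }, ?_, fun z => rfl⟩
    · intro a b
      apply Subtype.ext
      change (γ : Module.End K L) ⁅(a : L), (b : L)⁆ =
        ⁅(a : L), (γ : Module.End K L) b⁆ - ⁅(b : L), (γ : Module.End K L) a⁆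
      rw [T.map_lie γ.2, ← lie_skew (b : L)]
      abel
    · intro γ' hγ' n
      exact Subtype.ext (T.gammaRad_comm hγ hγ' n)
  exact ⟨⟨_, hmem⟩, ⟨γ, hγ, fun z => rfl⟩, fun z => rfl⟩

theorem isSemisimple_of_mem_torus {y : T.frakB} (hy : y ∈ T.torus) :
    (y : Module.End K T.m).IsSemisimple := by
  obtain ⟨γ, hγ, hy⟩ := hy
  have := T.mcr.prop.2.complementedLattice
  have h1 : (γ : Module.End K L).IsSemisimple :=
    isSemisimple_toEnd_of_mem_center L (T.gammaRad_le_center hγ)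
  have hst : T.m ∈ (γ : Module.End K L).invtSubmodule := fun z hz => T.map_m γ.2 hz
  have h2 : (y : Module.End K T.m) = (γ : Module.End K L).restrict hst := by
    ext z
    exact hy z
  rw [h2]
  exact h1.restrict hst

/-- Such a `z` is killed by all of `Γ = ad s + gammaRad`, hence lies in `k ∩ m = 0`. -/
theorem eq_zero_of_forall_torus (z : T.m) (hs : ∀ x, T.sAct x z = 0)
    (ht : ∀ y ∈ T.torus, (y : Module.End K T.m) z = 0) : z = 0 := by
  have hk : (z : L) ∈ T.k := by
    rw [T.mem_k_iff]
    intro γ hγ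
    obtain ⟨x, γ₀, hγ₀, h⟩ := T.exists_sub_ad_mem_gammaRad ⟨γ, hγ⟩
    obtain ⟨y, hy, hyγ⟩ := T.exists_mem_torus hγ₀
    have h1 : ⁅(x : L), (z : L)⁆ = 0 := congrArg Subtype.val (hs x)
    have h2 := h z
    rw [h1, ← hyγ, ht y hy, zero_add] at h2
    exact h2
  exact Subtype.ext (Submodule.disjoint_def.1 T.disjoint_m_k _ z.2 hk)

/-- As `Γ` kills `k`, `m = Γ · rad L = Γ · m`, which is spanned by `s · m` and `torus · m`. -/
theorem eq_top_of_forall_torus (P : Submodule K T.m) (hs : ∀ x z, T.sAct x z ∈ P)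
    (ht : ∀ y ∈ T.torus, ∀ z, (y : Module.End K T.m) z ∈ P) : P = ⊤ := by
  have hle : T.m ≤ P.map T.m.subtype := by
    conv_lhs => rw [T.m_eq]
    rw [Submodule.span_le]
    rintro _ ⟨γ, hγ, x, hx, rfl⟩
    obtain ⟨a, γ₀, hγ₀, h⟩ := T.exists_sub_ad_mem_gammaRad ⟨γ, hγ⟩
    obtain ⟨y, hy, hyγ⟩ := T.exists_mem_torus hγ₀
    have h1 : γ x = γ (T.mProj x : L) := by
      conv_lhs => rw [T.decomp hx]
      rw [map_add, (T.mem_k_iff _).1 (T.kProj x).2 γ hγ, zero_add]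
    refine ⟨T.sAct a (T.mProj x) + (y : Module.End K T.m) (T.mProj x),
      P.add_mem (hs _ _) (ht y hy _), ?_⟩
    rw [h1, h (T.mProj x : L), ← hyγ]
    rfl
  rw [eq_top_iff]
  rintro z -
  obtain ⟨w, hw, hwz⟩ := hle z.2
  have : w = z := Subtype.ext hwz
  exact this ▸ hw

end GammaStructure

end GammaTriple
end GammaDecomp

/-! ### Restriction of a derivation to a semisimple subalgebra; kernels of semisimple endomorphisms.
-/

namespace GammaDecomp

/-- Whitehead's first lemma for a derivation restricted to a semisimple subalgebra. -/
theorem exists_derivation_apply_eq_lie {K : Type*} [Field K] [CharZero K] {s M : Type*}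
    [LieRing s] [LieAlgebra K s] [FiniteDimensional K s] [LieAlgebra.IsKilling K s] [LieRing M]
    [LieAlgebra K M] [FiniteDimensional K M] (f : s →ₗ⁅K⁆ M) (D : LieDerivation K M M) :
    ∃ v : M, ∀ x, D (f x) = ⁅f x, v⁆ := by
  let _ : LieRingModule s M := LieRingModule.compLieHom M f
  have : LieModule K s M := LieModule.compLieHom M f
  let c : LieDerivation K s M :=
    { toLinearMap := D.toLinearMap ∘ₗ f.toLinearMap
      leibniz' := fun a b => by
        change D (f ⁅a, b⁆) = ⁅f a, D (f b)⁆ - ⁅f b, D (f a)⁆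
        rw [LieHom.map_lie, LieDerivation.apply_lie_eq_sub] }
  exact exists_lie_eq_of_isKilling c

/-- A semisimple endomorphism `f` satisfies `ker f² = ker f`. -/
theorem apply_eq_zero_of_isSemisimple {K V : Type*} [Field K] [AddCommGroup V] [Module K V]
    {f : Module.End K V} (hf : f.IsSemisimple) {v : V} (h : f (f v) = 0) : f v = 0 := by
  have hst : LinearMap.ker (f ^ 2) ∈ f.invtSubmodule := by
    intro x hx
    have hx' : (f ^ 2) x = 0 := hx
    change (f ^ 2) (f x) = 0
    rw [← Module.End.mul_apply, ← pow_succ, pow_succ', Module.End.mul_apply, hx', map_zero]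
  have hnil : IsNilpotent (f.restrict (p := LinearMap.ker (f ^ 2)) (q := LinearMap.ker (f ^ 2))
      fun x hx => hst hx) := by
    refine ⟨2, ?_⟩
    ext x
    have hx : f (f (x : V)) = 0 := (LinearMap.congr_fun (pow_two f) _).symm.trans x.2
    exact (congrArg Subtype.val (LinearMap.congr_fun (pow_two _) x)).trans hx
  have h0 := Module.End.eq_zero_of_isNilpotent_isSemisimple hnil (hf.restrict hst)
  have hv : (f ^ 2) v = 0 := by rw [pow_two]; exact h
  exact congrArg Subtype.val (LinearMap.congr_fun h0 ⟨v, hv⟩)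

/-- If `[t, [t, y]] = 0` with `t` semisimple, then `t` and `y` commute. -/
theorem lie_eq_zero_of_isSemisimple {K V : Type*} [Field K] [CharZero K] [AddCommGroup V]
    [Module K V] [FiniteDimensional K V] {t y : Module.End K V} (ht : t.IsSemisimple)
    (h : ⁅t, ⁅t, y⁆⁆ = 0) : ⁅t, y⁆ = 0 :=
  apply_eq_zero_of_isSemisimple (LieAlgebra.ad_isSemisimple_of_isSemisimple ht) h

/-! ### Inclusions, projections and brackets of `s ⊕ 𝔅 ⊕ m`. -/

namespace GammaTriple

variable {K : Type u} [Field K] {L : Type v} [LieRing L] [LieAlgebra K L] [FiniteDimensional K L]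
  {Γ : LieSubalgebra K (Module.End K L)} (T : GammaTriple Γ)

instance finiteDimensional_ext : FiniteDimensional K T.Ext :=
  inferInstanceAs (FiniteDimensional K (T.s × T.frakB × T.m))

/-- The inclusion of `𝔅`. -/
def inB : T.frakB →ₗ[K] T.Ext where
  toFun y := ((0, y, 0) : T.s × T.frakB × T.m)
  map_add' _ _ := T.ext_components (add_zero _).symm rfl (add_zero _).symm
  map_smul' _ _ := T.ext_components (smul_zero _).symm rfl (smul_zero _).symm

/-- The inclusion of `m`. -/
def inM : T.m →ₗ[K] T.Ext where
  toFun z := ((0, 0, z) : T.s × T.frakB × T.m)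
  map_add' _ _ := T.ext_components (add_zero _).symm (add_zero _).symm rfl
  map_smul' _ _ := T.ext_components (smul_zero _).symm (smul_zero _).symm rfl

/-- The projection onto `s`. -/
def prS : T.Ext →ₗ⁅K⁆ T.s where
  toFun u := u.1
  map_add' _ _ := rfl
  map_smul' _ _ := rfl
  map_lie' := rfl

/-- The projection onto `𝔅`. -/
def prB : T.Ext →ₗ[K] T.frakB where
  toFun u := u.2.1
  map_add' _ _ := rfl
  map_smul' _ _ := rfl

/-- The projection onto `m`. -/
def prM : T.Ext →ₗ[K] T.m where
  toFun u := u.2.2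
  map_add' _ _ := rfl
  map_smul' _ _ := rfl

/-- The inclusion of `s`. -/
noncomputable def inS : T.s →ₗ⁅K⁆ T.Ext where
  toFun x := ((x, 0, 0) : T.s × T.frakB × T.m)
  map_add' _ _ := T.ext_components rfl (add_zero _).symm (add_zero _).symm
  map_smul' _ _ := T.ext_components rfl (smul_zero _).symm (smul_zero _).symm
  map_lie' := by
    intro a b
    refine T.ext_components rfl ?_ ?_
    · change (0 : T.frakB) = ⁅(0 : T.frakB), (0 : T.frakB)⁆ + T.kap 0 0
      rw [lie_self, map_zero, add_zero]
    · change (0 : T.m) = T.sAct a 0 - T.sAct b 0 + ((0 : T.frakB) : Module.End K T.m) 0 -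
        ((0 : T.frakB) : Module.End K T.m) 0 + T.om 0 0
      simp

@[simp] theorem prS_inS (x : T.s) : T.prS (T.inS x) = x := rfl
@[simp] theorem prB_inS (x : T.s) : T.prB (T.inS x) = 0 := rfl
@[simp] theorem prM_inS (x : T.s) : T.prM (T.inS x) = 0 := rfl
@[simp] theorem prS_inB (y : T.frakB) : T.prS (T.inB y) = 0 := rfl
@[simp] theorem prB_inB (y : T.frakB) : T.prB (T.inB y) = y := rfl
@[simp] theorem prM_inB (y : T.frakB) : T.prM (T.inB y) = 0 := rfl
@[simp] theorem prS_inM (z : T.m) : T.prS (T.inM z) = 0 := rfl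
@[simp] theorem prB_inM (z : T.m) : T.prB (T.inM z) = 0 := rfl
@[simp] theorem prM_inM (z : T.m) : T.prM (T.inM z) = z := rfl

theorem ext_pr {u v : T.Ext} (h1 : T.prS u = T.prS v) (h2 : T.prB u = T.prB v)
    (h3 : T.prM u = T.prM v) : u = v :=
  T.ext_components h1 h2 h3

theorem prS_lie (u v : T.Ext) : T.prS ⁅u, v⁆ = ⁅T.prS u, T.prS v⁆ := rfl

theorem prB_lie (u v : T.Ext) :
    T.prB ⁅u, v⁆ = ⁅T.prB u, T.prB v⁆ + T.kap (T.prM u) (T.prM v) := rfl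

theorem prM_lie (u v : T.Ext) : T.prM ⁅u, v⁆ =
    T.sAct (T.prS u) (T.prM v) - T.sAct (T.prS v) (T.prM u) +
      (T.prB u : Module.End K T.m) (T.prM v) - (T.prB v : Module.End K T.m) (T.prM u) +
      T.om (T.prM u) (T.prM v) := rfl

theorem inS_lie_inB (x : T.s) (y : T.frakB) : ⁅T.inS x, T.inB y⁆ = 0 := by
  refine T.ext_pr ?_ ?_ ?_
  · simp
  · simp [prB_lie]
  · simp [prM_lie]

theorem inS_lie_inM (x : T.s) (z : T.m) : ⁅T.inS x, T.inM z⁆ = T.inM (T.sAct x z) := by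
  refine T.ext_pr ?_ ?_ ?_
  · simp
  · simp [prB_lie]
  · simp [prM_lie]

theorem inB_lie_inB (y y' : T.frakB) : ⁅T.inB y, T.inB y'⁆ = T.inB ⁅y, y'⁆ := by
  refine T.ext_pr ?_ ?_ ?_
  · simp
  · simp [prB_lie]
  · simp [prM_lie]

theorem inB_lie_inM (y : T.frakB) (z : T.m) :
    ⁅T.inB y, T.inM z⁆ = T.inM ((y : Module.End K T.m) z) := by
  refine T.ext_pr ?_ ?_ ?_
  · simp
  · simp [prB_lie]
  · simp [prM_lie]

theorem eq_add (u : T.Ext) : u = T.inS (T.prS u) + T.inB (T.prB u) + T.inM (T.prM u) := by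
  refine T.ext_pr ?_ ?_ ?_ <;> simp

/-! ### Triviality of the center. -/

section Center

theorem s_eq_zero_of_forall_lie (x : T.s) (h : ∀ a : T.s, ⁅a, x⁆ = 0) : x = 0 := by
  have hx : x ∈ LieAlgebra.center K T.s := (LieModule.mem_maxTrivSubmodule K T.s T.s x).2 h
  rwa [LieAlgebra.center_eq_bot, LieSubmodule.mem_bot] at hx

variable [CharZero K]

theorem center_ext_eq_bot : LieAlgebra.center K T.Ext = ⊥ := by
  rw [LieSubmodule.eq_bot_iff]
  intro u hu
  have hu' : ∀ w : T.Ext, ⁅w, u⁆ = 0 := (LieModule.mem_maxTrivSubmodule K T.Ext T.Ext u).1 hu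
  have hS : T.prS u = 0 := T.s_eq_zero_of_forall_lie _ fun a => congrArg T.prS (hu' (T.inS a))
  have hM : T.prM u = 0 := by
    refine T.eq_zero_of_forall_torus _ (fun x => ?_) fun y hy => ?_
    · have h := congrArg T.prM (hu' (T.inS x))
      simpa [prM_lie] using h
    · have h := congrArg T.prM (hu' (T.inB y))
      simpa [prM_lie] using h
  have hB : T.prB u = 0 := by
    apply Subtype.ext
    ext z : 1
    have h := congrArg T.prM (hu' (T.inM z))
    simpa [prM_lie, hS, hM] using h
  exact T.ext_pr hS hB hM

end Center

/-! ### The embedding of `L` and the recognition of elements of `𝔅`. -/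

section Embedding

theorem kProj_of_mem_s {x : L} (hx : x ∈ T.s) : T.kProj x = 0 :=
  (Submodule.projectionOnto_apply_eq_zero_iff T.isCompl_k).2 (Submodule.mem_sup_left hx)

theorem mProj_of_mem_s {x : L} (hx : x ∈ T.s) : T.mProj x = 0 :=
  (Submodule.projectionOnto_apply_eq_zero_iff T.isCompl_m).2 (Submodule.mem_sup_left hx)

theorem eq_sProj_add_kProj_add_mProj (x : L) :
    x = (T.sProj x : L) + ((T.kProj x : L) + (T.mProj x : L)) := by
  have h := T.decomp (T.sub_sProj_mem x)
  rw [map_sub, map_sub, T.kProj_of_mem_s (T.sProj x).2, T.mProj_of_mem_s (T.sProj x).2, sub_zero,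
    sub_zero] at h
  rw [← h, add_sub_cancel]

theorem muB_lie (a b : T.k) : T.muB ⁅a, b⁆ = ⁅T.muB a, T.muB b⁆ := by
  apply Subtype.ext
  ext z
  exact lie_lie (a : L) (b : L) (z : L)

/-- The homomorphism `L → s ⊕ 𝔅 ⊕ m` that extends `μ`. -/
noncomputable def toExt : L →ₗ⁅K⁆ T.Ext where
  toFun x := ((T.sProj x, T.muB (T.kProj x), T.mProj x) : T.s × T.frakB × T.m)
  map_add' x y := T.ext_components (map_add T.sProj x y)
    (by
      change T.muB (T.kProj (x + y)) = T.muB (T.kProj x) + T.muB (T.kProj y)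
      rw [map_add, map_add]) (map_add T.mProj x y)
  map_smul' c x := T.ext_components (map_smul T.sProj c x)
    (by
      change T.muB (T.kProj (c • x)) = c • T.muB (T.kProj x)
      rw [map_smul, map_smul])
    (map_smul T.mProj c x)
  map_lie' := by
    intro x y
    set a := T.sProj x with ha
    set a' := T.sProj y with ha'
    set b := T.kProj x with hb
    set b' := T.kProj y with hb'
    set c := T.mProj x with hc
    set c' := T.mProj y with hc'
    have hxy : ⁅x, y⁆ = (⁅a, a'⁆ : T.s) + (⁅b, b'⁆ : T.k) +
        ((T.sAct a c' : L) - T.sAct a' c + T.mu b c' - T.mu b' c) + ⁅(c : L), (c' : L)⁆ := by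
      conv_lhs => rw [T.eq_sProj_add_kProj_add_mProj x, T.eq_sProj_add_kProj_add_mProj y]
      simp only [← ha, ← ha', ← hb, ← hb', ← hc, ← hc', add_lie, lie_add, LieSubalgebra.coe_bracket,
        coe_sAct, coe_mu]
      rw [T.lie_s_k a a.2 b' b'.2, ← lie_skew (b : L) (a' : L), T.lie_s_k a' a'.2 b b.2,
        ← lie_skew (c : L) (a' : L), ← lie_skew (c : L) (b' : L)]
      abel
    have hmem : (T.sAct a c' : L) - T.sAct a' c + T.mu b c' - T.mu b' c ∈ T.m :=
      sub_mem (add_mem (sub_mem (Subtype.prop _) (Subtype.prop _)) (Subtype.prop _))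
        (Subtype.prop _)
    refine T.ext_components (LieHom.map_lie T.sProj x y) ?_ ?_
    · change T.muB (T.kProj ⁅x, y⁆) =
        ⁅T.muB b, T.muB b'⁆ + T.muB (T.kProj ⁅(c : L), (c' : L)⁆)
      rw [hxy, map_add T.kProj, map_add T.kProj, map_add T.kProj,
        T.kProj_of_mem_s (Subtype.prop ⁅a, a'⁆), T.kProj_of_mem_k (Subtype.prop ⁅b, b'⁆),
        T.kProj_of_mem_m hmem, zero_add, add_zero, map_add, ← muB_lie]
    · change T.mProj ⁅x, y⁆ = T.sAct a c' - T.sAct a' c + T.mu b c' - T.mu b' c +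
        T.mProj ⁅(c : L), (c' : L)⁆
      rw [hxy, map_add T.mProj, map_add T.mProj, map_add T.mProj,
        T.mProj_of_mem_s (Subtype.prop ⁅a, a'⁆), T.mProj_of_mem_k (Subtype.prop ⁅b, b'⁆),
        T.mProj_of_mem_m hmem, zero_add, zero_add]
      rfl

theorem prB_toExt (x : L) : T.prB (T.toExt x) = T.muB (T.kProj x) := rfl

theorem toExt_coe_m (z : T.m) : T.toExt (z : L) = T.inM z := by
  refine T.ext_pr ?_ ?_ ?_
  · exact T.sProj_eq_zero_iff.2 (T.m_le_radical z.2)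
  · rw [prB_toExt, T.kProj_of_mem_m z.2, map_zero]; rfl
  · exact T.mProj_of_mem_m z.2

theorem toExt_coe_s (x : T.s) : T.toExt (x : L) = T.inS x := by
  refine T.ext_pr ?_ ?_ ?_
  · exact T.sProj_coe x
  · rw [prB_toExt, T.kProj_of_mem_s x.2, map_zero]; rfl
  · exact T.mProj_of_mem_s x.2

variable {T}

/-- The kernel of `toExt` is `ker μ`; this is the point where the injectivity of `μ` acts. -/
theorem toExt_injective (hμ : Function.Injective T.mu) : Function.Injective T.toExt := by
  rw [injective_iff_map_eq_zero]
  intro x hx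
  have h1 : T.sProj x = 0 := congrArg T.prS hx
  have h2 : T.mu (T.kProj x) = 0 := congrArg Subtype.val (congrArg T.prB hx)
  have h3 : T.mProj x = 0 := congrArg T.prM hx
  have h2' : T.kProj x = 0 := hμ (h2.trans (map_zero T.mu).symm)
  rw [T.eq_sProj_add_kProj_add_mProj x, h1, h2', h3]
  simp

/-- An endomorphism of `m` commuting with `Γ` that is the restriction of a derivation of
`s ⊕ 𝔅 ⊕ m` belongs to `𝔅`. -/
theorem mem_frakB_of_derivation (hμ : Function.Injective T.mu) (D : LieDerivation K T.Ext T.Ext)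
    (y : Module.End K T.m) (hDy : ∀ z, D (T.inM z) = T.inM (y z))
    (hcomm : ∀ (γ : Module.End K L) (hγ : γ ∈ Γ) (z : T.m),
      (y ⟨γ z, T.map_m hγ z.2⟩ : L) = γ (y z : L)) : y ∈ T.frakB := by
  obtain ⟨σ, hσ⟩ := LinearMap.exists_leftInverse_of_injective T.toExt.toLinearMap
    (LinearMap.ker_eq_bot.2 (toExt_injective hμ))
  have hσ' : ∀ x, σ (T.toExt x) = x := fun x => LinearMap.congr_fun hσ x
  -- `D` need not preserve the image of `L`, but it preserves that of `n̂`, which is generated by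
  -- the stable space `m`.
  have hex : ∀ n ∈ T.nHat, ∃ n' ∈ T.nHat, T.toExt n' = D (T.toExt n) := by
    intro n hn
    unfold nHat at hn
    induction hn using LieSubalgebra.lieSpan_induction with
    | mem x hx =>
      exact ⟨y ⟨x, hx⟩, T.m_le_nHat (Subtype.prop _), by
        rw [toExt_coe_m, ← hDy, ← toExt_coe_m]⟩
    | zero => exact ⟨0, zero_mem _, by simp⟩
    | add a b _ _ ha hb =>
      obtain ⟨a', ha', ha⟩ := ha
      obtain ⟨b', hb', hb⟩ := hb
      exact ⟨a' + b', add_mem ha' hb', by rw [map_add, map_add, map_add, ha, hb]⟩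
    | smul t a _ ha =>
      obtain ⟨a', ha', ha⟩ := ha
      exact ⟨t • a', SMulMemClass.smul_mem t ha', by rw [map_smul, map_smul, map_smul, ha]⟩
    | lie a b ha₀ hb₀ ha hb =>
      obtain ⟨a', ha', ha⟩ := ha
      obtain ⟨b', hb', hb⟩ := hb
      refine ⟨⁅a, b'⁆ + ⁅a', b⁆, add_mem (LieSubalgebra.lie_mem _ ha₀ hb')
        (LieSubalgebra.lie_mem _ ha' hb₀), ?_⟩
      rw [map_add, LieHom.map_lie, LieHom.map_lie, LieHom.map_lie, LieDerivation.apply_lie_eq_add,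
        ha, hb]
  let E : Module.End K L := σ ∘ₗ D.toLinearMap ∘ₗ T.toExt.toLinearMap
  have hE : ∀ n ∈ T.nHat, E n ∈ T.nHat ∧ T.toExt (E n) = D (T.toExt n) := by
    intro n hn
    obtain ⟨n', hn', h⟩ := hex n hn
    have : E n = n' := by
      change σ (D (T.toExt n)) = n'
      rw [← h, hσ']
    rw [this]
    exact ⟨hn', h⟩
  have hEm : ∀ z : T.m, E z = y z := fun z => by
    change σ (D (T.toExt (z : L))) = y z
    rw [toExt_coe_m, hDy, ← toExt_coe_m, hσ']
  have hElie : ∀ a ∈ T.nHat, ∀ b ∈ T.nHat, E ⁅a, b⁆ = ⁅a, E b⁆ + ⁅E a, b⁆ := by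
    intro a ha b hb
    apply toExt_injective hμ
    rw [(hE _ (LieSubalgebra.lie_mem _ ha hb)).2, map_add, LieHom.map_lie, LieHom.map_lie,
      LieHom.map_lie, LieDerivation.apply_lie_eq_add, (hE a ha).2, (hE b hb).2]
  -- On `n̂` both `E` and `γ` are derivations, so commutation propagates from the generators in `m`.
  have hEγ : ∀ (γ : Module.End K L) (_ : γ ∈ Γ), ∀ n ∈ T.nHat, E (γ n) = γ (E n) := by
    intro γ hγ n hn
    unfold nHat at hn
    induction hn using LieSubalgebra.lieSpan_induction with
    | mem x hx =>
      have h := hcomm γ hγ ⟨x, hx⟩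
      rw [← hEm, ← hEm] at h
      exact h
    | zero => simp
    | add a b _ _ ha hb => rw [map_add, map_add, map_add, map_add, ha, hb]
    | smul t a _ ha => rw [map_smul, map_smul, map_smul, map_smul, ha]
    | lie a b ha₀ hb₀ ha hb =>
      rw [T.map_lie hγ, map_add, hElie _ (T.map_nHat hγ ha₀) _ hb₀,
        hElie _ ha₀ _ (T.map_nHat hγ hb₀), hElie _ ha₀ _ hb₀, map_add, T.map_lie hγ, T.map_lie hγ,
        ha, hb]
      abel
  refine ⟨{ toLinearMap := E.restrict fun n hn => (hE n hn).1, leibniz' := ?_ }, ?_, hEm⟩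
  · intro a b
    apply Subtype.ext
    change E ⁅(a : L), (b : L)⁆ = ⁅(a : L), E b⁆ - ⁅(b : L), E a⁆
    rw [hElie a a.2 b b.2, ← lie_skew (b : L), sub_neg_eq_add]
  · intro γ hγ n
    exact Subtype.ext (hEγ γ hγ n n.2)

end Embedding

end GammaTriple
end GammaDecomp

namespace GammaDecomp
namespace GammaTriple

theorem derivation_inS_lie {K : Type u} [Field K] {L : Type v} [LieRing L] [LieAlgebra K L]
    [FiniteDimensional K L] {Γ : LieSubalgebra K (Module.End K L)} {T : GammaTriple Γ}
    {D : LieDerivation K T.Ext T.Ext} (hS : ∀ x, D (T.inS x) = 0) (x : T.s) (w : T.Ext) :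
    D ⁅T.inS x, w⁆ = ⁅T.inS x, D w⁆ := by
  rw [LieDerivation.apply_lie_eq_add, hS, zero_lie, add_zero]

/-! ### Normalization of a derivation and proof that it is inner. -/

section Derivations

variable {K : Type u} [Field K] [CharZero K] {L : Type v} [LieRing L] [LieAlgebra K L]
  [FiniteDimensional K L] {Γ : LieSubalgebra K (Module.End K L)} {T : GammaTriple Γ}

/-- Up to an inner derivation, a derivation of `s ⊕ 𝔅 ⊕ m` vanishes on `s` and maps the torus
into `𝔅`. -/
theorem exists_sub_ad_normalized (D : LieDerivation K T.Ext T.Ext) :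
    ∃ u : T.Ext, (∀ x, D (T.inS x) = ⁅u, T.inS x⁆) ∧
      ∀ y ∈ T.torus, T.prS (D (T.inB y) - ⁅u, T.inB y⁆) = 0 ∧
        T.prM (D (T.inB y) - ⁅u, T.inB y⁆) = 0 := by
  obtain ⟨v, hv⟩ := exists_derivation_apply_eq_lie T.inS D
  let D₁ : LieDerivation K T.Ext T.Ext := D + LieDerivation.ad K T.Ext v
  have hD₁ : ∀ w, D₁ w = D w + ⁅v, w⁆ := fun w => by
    change (D + LieDerivation.ad K T.Ext v) w = _
    rw [LieDerivation.add_apply, LieDerivation.ad_apply_apply]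
  have hs : ∀ x, D₁ (T.inS x) = 0 := fun x => by
    rw [hD₁, hv, ← lie_skew, neg_add_cancel]
  have hcent : ∀ (x : T.s) (w : T.Ext), ⁅T.inS x, w⁆ = 0 → ⁅T.inS x, D₁ w⁆ = 0 := by
    intro x w h
    have h1 := D₁.apply_lie_eq_add (T.inS x) w
    rw [h, map_zero, hs, zero_lie, add_zero] at h1
    exact h1.symm
  have hS : ∀ y : T.frakB, T.prS (D₁ (T.inB y)) = 0 := fun y =>
    T.s_eq_zero_of_forall_lie _ fun a => congrArg T.prS (hcent a _ (T.inS_lie_inB a y))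
  have hsM : ∀ (y : T.frakB) (x : T.s), T.sAct x (T.prM (D₁ (T.inB y))) = 0 := fun y x => by
    have h := congrArg T.prM (hcent x _ (T.inS_lie_inB x y))
    simpa [prM_lie] using h
  -- The space `m^s` contains the `m`-components of `D₁` on `𝔅`, since `s` centralizes `𝔅` and `D₁`
  -- vanishes on `s`.
  let W : Submodule K T.m :=
    { carrier := {z | ∀ x, T.sAct x z = 0}
      add_mem' := fun ha hb x => by rw [map_add, ha x, hb x, add_zero]
      zero_mem' := fun x => map_zero _
      smul_mem' := fun c z hz x => by rw [map_smul, hz x, smul_zero] }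
  have hker : ∀ (y : T.torus) (z : T.m), ((y : T.frakB) : Module.End K T.m)
      (((y : T.frakB) : Module.End K T.m) z) = 0 → ((y : T.frakB) : Module.End K T.m) z = 0 := by
    exact fun y z hz => apply_eq_zero_of_isSemisimple (T.isSemisimple_of_mem_torus y.2) hz
  have hcomm : ∀ (y y' : T.torus) (z : T.m), ((y : T.frakB) : Module.End K T.m)
      (((y' : T.frakB) : Module.End K T.m) z) = ((y' : T.frakB) : Module.End K T.m)
      (((y : T.frakB) : Module.End K T.m) z) := by
    intro y y' z
    have h := LinearMap.congr_fun (congrArg Subtype.val (T.lie_torus (y : T.frakB) y'.2)) z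
    exact sub_eq_zero.1 h
  obtain ⟨v₀, hv₀, h⟩ := exists_forall_eq_apply_of_commuting
    (fun y : T.torus => ((y : T.frakB) : Module.End K T.m)) hker hcomm W
    (fun y w hw x => by rw [← T.B_sAct, hw x, map_zero])
    (fun w hw h => T.eq_zero_of_forall_torus w hw fun y hy => h ⟨y, hy⟩)
    (fun y => T.prM (D₁ (T.inB y))) (fun y => hsM y) (by
      intro y y'
      have h1 := D₁.apply_lie_eq_add (T.inB y) (T.inB y')
      rw [T.inB_lie_inB, T.lie_torus _ y'.2, map_zero, map_zero] at h1
      have h2 := congrArg T.prM h1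
      simp only [map_zero, map_add, prM_lie, prS_inB, prM_inB, prB_inB, hS, LinearMap.zero_apply,
        sub_zero, zero_sub, add_zero, zero_add] at h2
      rw [← sub_eq_add_neg] at h2
      exact (sub_eq_zero.1 h2.symm))
  -- Subtracting this inner derivation turns `D` into `D₁ + ad v₀`, which still vanishes on `s`
  -- because `v₀ ∈ m^s`.
  refine ⟨T.inM (-v₀) - v, fun x => ?_, fun y hy => ?_⟩
  · rw [sub_lie, map_neg, neg_lie, ← lie_skew _ (T.inS x), neg_neg, T.inS_lie_inM, hv₀ x, map_zero,
      zero_sub, hv, lie_skew]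
  · have e : D (T.inB y) - ⁅T.inM (-v₀) - v, T.inB y⁆ =
        D₁ (T.inB y) - T.inM ((y : Module.End K T.m) v₀) := by
      rw [hD₁, sub_lie, map_neg, neg_lie, ← lie_skew _ (T.inB y), neg_neg, T.inB_lie_inM]
      abel
    rw [e, map_sub, map_sub, hS, prS_inM, sub_zero, prM_inM]
    exact ⟨rfl, sub_eq_zero.2 (h ⟨y, hy⟩)⟩

variable {D : LieDerivation K T.Ext T.Ext} (hS : ∀ x, D (T.inS x) = 0)
  (hT : ∀ y ∈ T.torus, T.prS (D (T.inB y)) = 0 ∧ T.prM (D (T.inB y)) = 0)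

include hS hT in
-- `D(y)` centralizes `s`, so its `s`-component is central in `s`. Its `m`-component is killed by
-- `s` and, on applying `D` to `[y, t] = 0`, by every `t ∈ torus`.
theorem derivation_inB (y : T.frakB) : D (T.inB y) = T.inB (T.prB (D (T.inB y))) := by
  have hc : ∀ x, ⁅T.inS x, D (T.inB y)⁆ = 0 := fun x => by
    rw [← derivation_inS_lie hS, T.inS_lie_inB, map_zero]
  refine T.ext_pr ?_ rfl ?_
  · exact T.s_eq_zero_of_forall_lie _ fun a => congrArg T.prS (hc a)
  · refine T.eq_zero_of_forall_torus _ (fun x => ?_) fun t ht => ?_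
    · have h := congrArg T.prM (hc x)
      simpa [prM_lie] using h
    · have h1 := D.apply_lie_eq_add (T.inB y) (T.inB t)
      rw [T.inB_lie_inB, T.lie_torus _ ht, map_zero, map_zero] at h1
      have h2 := congrArg T.prM h1
      simpa [prM_lie, (hT t ht).1, (hT t ht).2] using h2

include hS hT in
-- The kernel of this component contains `s · m` and `torus · m`, as `s` and `torus` centralize `𝔅`
-- and `D` maps `torus` into `𝔅`.
theorem prB_derivation_inM (z : T.m) : T.prB (D (T.inM z)) = 0 := by
  have htop := T.eq_top_of_forall_torus
    (LinearMap.ker (T.prB ∘ₗ D.toLinearMap ∘ₗ T.inM)) (fun x z => ?_) (fun y hy z => ?_)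
  · have hz : z ∈ LinearMap.ker (T.prB ∘ₗ D.toLinearMap ∘ₗ T.inM) := htop ▸ Submodule.mem_top
    exact hz
  · change T.prB (D (T.inM (T.sAct x z))) = 0
    rw [← T.inS_lie_inM, derivation_inS_lie hS]
    simp [prB_lie]
  · change T.prB (D (T.inM ((y : Module.End K T.m) z))) = 0
    rw [← T.inB_lie_inM, LieDerivation.apply_lie_eq_add, derivation_inB hS hT y, T.inB_lie_inM]
    simp only [map_add, prB_lie, prB_inB, prM_inB, prB_inM, map_zero, LinearMap.zero_apply, add_zero]
    rw [← lie_skew, T.lie_torus _ hy, neg_zero]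

include hS in
-- The `s`-components of the powers of `D` on `L` form a higher derivation whose zeroth term kills
-- the radical. The image of the radical under the first term is an ideal, since `D` commutes with
-- `ad s`, and therefore vanishes.
theorem prS_derivation_inM (z : T.m) : T.prS (D (T.inM z)) = 0 := by
  let E : ℕ → L →ₗ[K] T.s := fun n =>
    T.prS.toLinearMap ∘ₗ (D.toLinearMap ^ n) ∘ₗ T.toExt.toLinearMap
  have hEapp : ∀ n x, E n x = T.prS (D^[n] (T.toExt x)) := fun n x => by
    change T.prS ((D.toLinearMap ^ n) (T.toExt x)) = _
    rw [Module.End.pow_apply]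
    rfl
  let J : LieIdeal K T.s :=
    { (LieAlgebra.radical K L).toSubmodule.map (E 1) with
      lie_mem := by
        rintro x _ ⟨u, hu, rfl⟩
        refine ⟨⁅(x : L), u⁆, lie_mem_right K L _ _ _ hu, ?_⟩
        rw [hEapp, hEapp, LieHom.map_lie, T.toExt_coe_s]
        change T.prS (D ⁅T.inS x, T.toExt u⁆) = ⁅x, T.prS (D (T.toExt u))⁆
        rw [derivation_inS_lie hS, prS_lie, prS_inS] }
  have hJ : J = ⊥ := by
    refine eq_bot_of_forall_exists_higherDerivation_eq E (fun n a b => ?_)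
      (LieAlgebra.radical K L) (fun u hu => ?_) J fun j hj => hj
    · rw [hEapp, LieHom.map_lie, LieDerivation.iterate_apply_lie', map_sum]
      refine Finset.sum_congr rfl fun i _ => ?_
      rw [map_nsmul, prS_lie, hEapp, hEapp]
    · rw [hEapp]
      exact T.sProj_eq_zero_iff.2 hu
  have hz : E 1 z ∈ J := ⟨z, T.m_le_radical z.2, rfl⟩
  rw [hJ, LieSubmodule.mem_bot, hEapp, T.toExt_coe_m] at hz
  exact hz

include hS hT in
theorem derivation_inM (z : T.m) : D (T.inM z) = T.inM (T.prM (D (T.inM z))) :=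
  T.ext_pr (prS_derivation_inM hS z) (prB_derivation_inM hS hT z) rfl

include hS hT in
theorem exists_eq_lie_inB (hμ : Function.Injective T.mu) :
    ∃ y : T.frakB, ∀ w, D w = ⁅T.inB y, w⁆ := by
  let y : Module.End K T.m := T.prM ∘ₗ D.toLinearMap ∘ₗ T.inM
  have hy : ∀ z, D (T.inM z) = T.inM (y z) := derivation_inM hS hT
  have hB : ∀ (b : T.frakB) (z : T.m), y ((b : Module.End K T.m) z) =
      (T.prB (D (T.inB b)) : Module.End K T.m) z + (b : Module.End K T.m) (y z) := by
    intro b z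
    have h := D.apply_lie_eq_add (T.inB b) (T.inM z)
    rw [T.inB_lie_inM, hy, hy, derivation_inB hS hT b, T.inB_lie_inM, T.inB_lie_inM, ← map_add] at h
    have h' := congrArg T.prM h
    rw [prM_inM, prM_inM, add_comm] at h'
    exact h'
  have htorus : ∀ t ∈ T.torus, ⁅(t : Module.End K T.m), y⁆ = 0 := by
    intro t ht
    refine lie_eq_zero_of_isSemisimple (T.isSemisimple_of_mem_torus ht) ?_
    -- The commutator with `y` falls in `𝔅`, which centralizes `t`; this gives `[t, [t, y]] = 0`.
    have h1 : ⁅(t : Module.End K T.m), y⁆ = -(T.prB (D (T.inB t)) : Module.End K T.m) := by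
      ext z : 1
      change (t : Module.End K T.m) (y z) - y ((t : Module.End K T.m) z) = _
      rw [hB, LinearMap.neg_apply]
      abel
    have h2 : ⁅(T.prB (D (T.inB t)) : Module.End K T.m), (t : Module.End K T.m)⁆ = 0 :=
      congrArg Subtype.val (T.lie_torus (T.prB (D (T.inB t))) ht)
    rw [h1, lie_neg, lie_skew, h2]
  have hsA : ∀ x z, y (T.sAct x z) = T.sAct x (y z) := by
    intro x z
    have h := derivation_inS_lie hS x (T.inM z)
    rw [T.inS_lie_inM, hy, hy, T.inS_lie_inM] at h
    exact congrArg T.prM h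
  have hmem : y ∈ T.frakB := by
    -- `Γ` acts on `m` through `s` and `torus`, both of which commute with `y`.
    refine mem_frakB_of_derivation hμ D y hy fun γ hγ z => ?_
    obtain ⟨x, γ₀, hγ₀, h⟩ := T.exists_sub_ad_mem_gammaRad ⟨γ, hγ⟩
    obtain ⟨t, ht, htγ⟩ := T.exists_mem_torus hγ₀
    have h1 : ∀ w : T.m, γ w = ((T.sAct x w + (t : Module.End K T.m) w : T.m) : L) := fun w => by
      rw [h w, ← htγ]
      rfl
    have h2 : (⟨γ z, T.map_m hγ z.2⟩ : T.m) = T.sAct x z + (t : Module.End K T.m) z :=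
      Subtype.ext (h1 z)
    have h3 : (t : Module.End K T.m) (y z) = y ((t : Module.End K T.m) z) :=
      sub_eq_zero.1 (LinearMap.congr_fun (htorus t ht) z)
    rw [h2, h1 (y z), map_add, hsA, h3]
  refine ⟨⟨y, hmem⟩, fun w => ?_⟩
  -- Both sides lie in `𝔅`, whose elements are determined by their action on `m`.
  have e1 : D (T.inB (T.prB w)) = ⁅T.inB ⟨y, hmem⟩, T.inB (T.prB w)⁆ := by
    rw [T.inB_lie_inB, derivation_inB hS hT]
    congr 1
    apply Subtype.ext
    ext z : 1
    change _ = y ((T.prB w : Module.End K T.m) z) - (T.prB w : Module.End K T.m) (y z)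
    rw [hB, add_sub_cancel_right]
  have e2 : D (T.inM (T.prM w)) = ⁅T.inB ⟨y, hmem⟩, T.inM (T.prM w)⁆ := by
    rw [T.inB_lie_inM, hy]
  have e3 : ⁅T.inB ⟨y, hmem⟩, T.inS (T.prS w)⁆ = 0 := by
    rw [← lie_skew, T.inS_lie_inB, neg_zero]
  rw [T.eq_add w, map_add, map_add, lie_add, lie_add, hS, e3]
  rw [zero_add, zero_add, e1, e2]

theorem exists_eq_lie (hμ : Function.Injective T.mu) (D : LieDerivation K T.Ext T.Ext) :
    ∃ u : T.Ext, ∀ w, D w = ⁅u, w⁆ := by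
  obtain ⟨u, hu, hu'⟩ := exists_sub_ad_normalized D
  have happ : ∀ w, (D - LieDerivation.ad K T.Ext u) w = D w - ⁅u, w⁆ := fun w => by
    rw [LieDerivation.sub_apply, LieDerivation.ad_apply_apply]
  obtain ⟨y, hy⟩ := exists_eq_lie_inB (D := D - LieDerivation.ad K T.Ext u)
    (fun x => by rw [happ, hu, sub_self]) (fun y hy => by rw [happ]; exact hu' y hy) hμ
  refine ⟨u + T.inB y, fun w => ?_⟩
  rw [add_lie, ← hy w, happ]
  abel

end Derivations

end GammaTriple
end GammaDecomp

theorem mainTheorem8 {K : Type u} [Field K] [CharZero K]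
    {L : Type v} [LieRing L] [LieAlgebra K L] [FiniteDimensional K L]
    (Γ : LieSubalgebra K (Module.End K L)) (T : GammaDecomp.GammaTriple Γ)
    (hμ : Function.Injective T.mu) :
    GammaDecomp.IsCompleteLieAlgebra K T.Ext :=
  ⟨T.center_ext_eq_bot, GammaDecomp.GammaTriple.exists_eq_lie hμ⟩
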